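/- All graphs are finite, simple and undirected. For a graph $G$ let $\rho(G)$ be the largest eigenvalue of its adjacency matrix, and let its matching number be the maximum number of pairwise disjoint edges of $G$. Let $\mathcal{G}_{n,4}$ be the set of connected graphs with $n$ vertices and matching number $4$. A minimizer of $\rho$ in $\mathcal{G}_{n,4}$ is a graph $T\in\mathcal{G}_{n,4}$ with $\rho(T)\le\rho(H)$ for all $H\in\mathcal{G}_{n,4}$. For integers $a,b,c,d\ge 0$, each tree $K_i(a,b,c,d)$, $1\le i\le 13$, is obtained from the skeleton listed below by attaching pendant vertices. Except for $i=11,12$, attach $a,b,c,d$ new pendant vertices at $v_1,v_2,v_3,v_4$ respectively; for $i=11,12$, attach $a$ at $v_1$, $b$ at $v_3$, $c$ at $v_4$ and $d$ at $v_2$. The skeletons (paths are written by listing their vertices) are: - $K_1$: $v_1v_2v_3v_4$; - $K_2$: $v_1u_1v_2v_3v_4$; - $K_3$: $v_1v_2u_1v_3v_4$; - $K_4$: $v_1u_1v_2u_2v_3v_4$; - $K_5$: $v_1u_1v_2v_3u_2v_4$; - $K_6$: $v_1u_1v_2u_2v_3u_3v_4$; - $K_7$: $v_1v_2v_3$ together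 with the edge $v_2v_4$; - $K_8$: $v_1u_1v_2v_3$ together with the edge $v_2v_4$; - $K_9$: $v_1u_1v_2u_2v_3$ together with the edge $v_2v_4$; - $K_{10}$: $v_1u_1v_2u_2v_3$ together with the path $v_2u_3v_4$; - $K_{11}$: $v_1u_1v_3v_4$ together with the edge $v_2u_1$; - $K_{12}$: $v_1u_1v_3u_2v_4$ together with the edge $v_2u_1$; - $K_{13}$: the star with center $u_1$ and leaves $v_1,v_2,v_3,v_4$. Let $n\ge 11$ and let $T$ be a minimizer of $\rho$ in $\mathcal{G}_{n,4}$. Then there are integers $a,b,c,d\ge 0$ with $a+b+c+d=n-7$ such that either $T\cong K_6(a,b,c,d)$ with $a,d\ge 1$, or $T\cong K_{10}(a,b,c,d)$ with $a,c,d\ge 1$. Moreover, for $i\in\{1,2,3,4,5,7,8,9,11,12,13\}$ and all integers $a,b,c,d\ge 0$, $T\not\cong K_i(a,b,c,d)$. -/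

import Mathlib

namespace MinSpectral

open Classical in
/-- The spectral radius of a finite graph: the largest eigenvalue of its (real symmetric)
adjacency matrix. -/
noncomputable def rho {V : Type*} [Fintype V] (G : SimpleGraph V) : ℝ :=
  sSup (spectrum ℝ (G.adjMatrix ℝ))

/-- The matching number of a finite graph: the largest number of edges of a matching. -/
noncomputable def matchingNumber {V : Type*} [Fintype V] (G : SimpleGraph V) : ℕ :=
  sSup {k : ℕ | ∃ M : G.Subgraph, M.IsMatching ∧ M.edgeSet.ncard = k}

/-- The family of connected graphs with `n` vertices and matching number `β`. -/
def family (n β : ℕ) : Set (SimpleGraph (Fin n)) :=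
  {G | G.Connected ∧ matchingNumber G = β}

/-- `G` has the least spectral radius in the family of connected graphs with `n` vertices and
matching number `β`. -/
def IsMinimizer (n β : ℕ) (G : SimpleGraph (Fin n)) : Prop :=
  G ∈ family n β ∧ ∀ H ∈ family n β, rho G ≤ rho H

/-- The graph obtained from a graph `S` and vertices `h 0, …, h 3` of it by attaching `c i` new
pendant vertices at the vertex `h i`, for every `i`. -/
def attachLeaves {W : Type*} (S : SimpleGraph W) (h : Fin 4 → W) (c : Fin 4 → ℕ) :
    SimpleGraph (W ⊕ ((i : Fin 4) × Fin (c i))) where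
  Adj
    | .inl u, .inl v => S.Adj u v
    | .inl u, .inr p => u = h p.1
    | .inr p, .inl u => u = h p.1
    | .inr _, .inr _ => False
  symm := ⟨by rintro (u | p) (v | q) <;> simp [S.adj_comm]⟩
  loopless := ⟨by rintro (u | p) <;> simp⟩

/-! In each tree below the vertices `v₁, v₂, v₃, v₄` of the skeleton are `0, 1, 2, 3 : Fin m`, the
other vertices `u` (or `u₁, u₂, u₃`) of the skeleton are `4, …, m - 1`. -/

/-- Skeleton `v₁ - v₂ - v₃ - v₄`; pendant vertices: `a` at `v₁`, `b` at `v₂`, `c` at `v₃`, `d` at `v₄`. -/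
def K1 (a b c d : ℕ) : SimpleGraph (Fin 4 ⊕ ((i : Fin 4) × Fin (![a, b, c, d] i))) :=
  attachLeaves (SimpleGraph.fromEdgeSet {s(0, 1), s(1, 2), s(2, 3)} : SimpleGraph (Fin 4))
    ![0, 1, 2, 3] ![a, b, c, d]

/-- Skeleton `v₁ - u - v₂ - v₃ - v₄`; pendant vertices: `a` at `v₁`, `b` at `v₂`, `c` at `v₃`, `d` at `v₄`. -/
def K2 (a b c d : ℕ) : SimpleGraph (Fin 5 ⊕ ((i : Fin 4) × Fin (![a, b, c, d] i))) :=
  attachLeaves (SimpleGraph.fromEdgeSet {s(0, 4), s(4, 1), s(1, 2), s(2, 3)} : SimpleGraph (Fin 5))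
    ![0, 1, 2, 3] ![a, b, c, d]

/-- Skeleton `v₁ - v₂ - u - v₃ - v₄`; pendant vertices: `a` at `v₁`, `b` at `v₂`, `c` at `v₃`, `d` at `v₄`. -/
def K3 (a b c d : ℕ) : SimpleGraph (Fin 5 ⊕ ((i : Fin 4) × Fin (![a, b, c, d] i))) :=
  attachLeaves (SimpleGraph.fromEdgeSet {s(0, 1), s(1, 4), s(4, 2), s(2, 3)} : SimpleGraph (Fin 5))
    ![0, 1, 2, 3] ![a, b, c, d]

/-- Skeleton `v₁ - u₁ - v₂ - u₂ - v₃ - v₄`; pendant vertices: `a` at `v₁`, `b` at `v₂`, `c` at `v₃`, `d` at `v₄`. -/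
def K4 (a b c d : ℕ) : SimpleGraph (Fin 6 ⊕ ((i : Fin 4) × Fin (![a, b, c, d] i))) :=
  attachLeaves (SimpleGraph.fromEdgeSet {s(0, 4), s(4, 1), s(1, 5), s(5, 2), s(2, 3)} : SimpleGraph (Fin 6))
    ![0, 1, 2, 3] ![a, b, c, d]

/-- Skeleton `v₁ - u₁ - v₂ - v₃ - u₂ - v₄`; pendant vertices: `a` at `v₁`, `b` at `v₂`, `c` at `v₃`, `d` at `v₄`. -/
def K5 (a b c d : ℕ) : SimpleGraph (Fin 6 ⊕ ((i : Fin 4) × Fin (![a, b, c, d] i))) :=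
  attachLeaves (SimpleGraph.fromEdgeSet {s(0, 4), s(4, 1), s(1, 2), s(2, 5), s(5, 3)} : SimpleGraph (Fin 6))
    ![0, 1, 2, 3] ![a, b, c, d]

/-- Skeleton `v₁ - u₁ - v₂ - u₂ - v₃ - u₃ - v₄`; pendant vertices: `a` at `v₁`, `b` at `v₂`, `c` at `v₃`, `d` at `v₄`. -/
def K6 (a b c d : ℕ) : SimpleGraph (Fin 7 ⊕ ((i : Fin 4) × Fin (![a, b, c, d] i))) :=
  attachLeaves (SimpleGraph.fromEdgeSet {s(0, 4), s(4, 1), s(1, 5), s(5, 2), s(2, 6), s(6, 3)} : SimpleGraph (Fin 7))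
    ![0, 1, 2, 3] ![a, b, c, d]

/-- Skeleton `v₁ - v₂ - v₃ and v₂ - v₄`; pendant vertices: `a` at `v₁`, `b` at `v₂`, `c` at `v₃`, `d` at `v₄`. -/
def K7 (a b c d : ℕ) : SimpleGraph (Fin 4 ⊕ ((i : Fin 4) × Fin (![a, b, c, d] i))) :=
  attachLeaves (SimpleGraph.fromEdgeSet {s(0, 1), s(1, 2), s(1, 3)} : SimpleGraph (Fin 4))
    ![0, 1, 2, 3] ![a, b, c, d]

/-- Skeleton `v₁ - u - v₂ - v₃ and v₂ - v₄`; pendant vertices: `a` at `v₁`, `b` at `v₂`, `c` at `v₃`, `d` at `v₄`. -/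
def K8 (a b c d : ℕ) : SimpleGraph (Fin 5 ⊕ ((i : Fin 4) × Fin (![a, b, c, d] i))) :=
  attachLeaves (SimpleGraph.fromEdgeSet {s(0, 4), s(4, 1), s(1, 2), s(1, 3)} : SimpleGraph (Fin 5))
    ![0, 1, 2, 3] ![a, b, c, d]

/-- Skeleton `v₁ - u₁ - v₂ - u₂ - v₃ and v₂ - v₄`; pendant vertices: `a` at `v₁`, `b` at `v₂`, `c` at `v₃`, `d` at `v₄`. -/
def K9 (a b c d : ℕ) : SimpleGraph (Fin 6 ⊕ ((i : Fin 4) × Fin (![a, b, c, d] i))) :=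
  attachLeaves (SimpleGraph.fromEdgeSet {s(0, 4), s(4, 1), s(1, 5), s(5, 2), s(1, 3)} : SimpleGraph (Fin 6))
    ![0, 1, 2, 3] ![a, b, c, d]

/-- Skeleton `v₁ - u₁ - v₂ - u₂ - v₃ and v₂ - u₃ - v₄`; pendant vertices: `a` at `v₁`, `b` at `v₂`, `c` at `v₃`, `d` at `v₄`. -/
def K10 (a b c d : ℕ) : SimpleGraph (Fin 7 ⊕ ((i : Fin 4) × Fin (![a, b, c, d] i))) :=
  attachLeaves (SimpleGraph.fromEdgeSet {s(0, 4), s(4, 1), s(1, 5), s(5, 2), s(1, 6), s(6, 3)} : SimpleGraph (Fin 7))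
    ![0, 1, 2, 3] ![a, b, c, d]

/-- Skeleton `v₁ - u - v₃ - v₄ and v₂ - u`; pendant vertices: `a` at `v₁`, `b` at `v₃`, `c` at `v₄`, `d` at `v₂`. -/
def K11 (a b c d : ℕ) : SimpleGraph (Fin 5 ⊕ ((i : Fin 4) × Fin (![a, b, c, d] i))) :=
  attachLeaves (SimpleGraph.fromEdgeSet {s(0, 4), s(1, 4), s(4, 2), s(2, 3)} : SimpleGraph (Fin 5))
    ![0, 2, 3, 1] ![a, b, c, d]

/-- Skeleton `v₁ - u₁ - v₃ - u₂ - v₄ and v₂ - u₁`; pendant vertices: `a` at `v₁`, `b` at `v₃`, `c` at `v₄`, `d` at `v₂`. -/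
def K12 (a b c d : ℕ) : SimpleGraph (Fin 6 ⊕ ((i : Fin 4) × Fin (![a, b, c, d] i))) :=
  attachLeaves (SimpleGraph.fromEdgeSet {s(0, 4), s(1, 4), s(4, 2), s(2, 5), s(5, 3)} : SimpleGraph (Fin 6))
    ![0, 2, 3, 1] ![a, b, c, d]

/-- Skeleton `v₁ - u - v₃ and v₂ - u - v₄`; pendant vertices: `a` at `v₁`, `b` at `v₂`, `c` at `v₃`, `d` at `v₄`. -/
def K13 (a b c d : ℕ) : SimpleGraph (Fin 5 ⊕ ((i : Fin 4) × Fin (![a, b, c, d] i))) :=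
  attachLeaves (SimpleGraph.fromEdgeSet {s(0, 4), s(4, 2), s(1, 4), s(4, 3)} : SimpleGraph (Fin 5))
    ![0, 1, 2, 3] ![a, b, c, d]

end MinSpectral

/-! A minimizer is a tree: some spanning tree contains a maximum matching, so it keeps the matching
number, and deleting edges of a connected graph while keeping it connected strictly lowers the
spectral radius (`rho_lt_of_lt`). König's theorem, proved here for forests, then gives a vertex
cover `C` with exactly four vertices.

Everything rests on a gap between two bounds. Suppose the tree has an edge inside `C`, or a vertex
outside `C` with three neighbours in `C`. A Rayleigh quotient with a test vector constant on `C`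
then gives `n + 6 ≤ 4ρ²` (`le_four_mul_rho_sq`). On the other hand, a suitable `K6 a b c d` whose
four cover vertices have degrees as equal as possible satisfies `4ρ² < n + 6`
(`exists_family_four_rho_sq_lt`). Hence in a minimizer every cover of size four is independent, and
every other vertex has one or two neighbours in it (`IsMinimizer.not_bad`).

Counting edges, exactly three outside vertices have two neighbours in `C`; they subdivide the edges
of a tree on the four cover vertices, and all remaining vertices are pendant at `C`. A tree on four
vertices is a path or a star, which gives `K6` and `K10`. A leaf of that small tree must carry a
pendant vertex: otherwise it could be exchanged in `C` for its only neighbour, and the new cover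
would contain an edge. The other eleven families are excluded directly, since their four attachment
vertices form a cover of the forbidden kind. -/

namespace MinSpectral

open SimpleGraph

/-! ### Matchings, vertex covers and König's theorem for forests -/

section Matching

variable {V : Type*}

/-- A graph all of whose edges are pairwise disjoint. -/
def IsMatchingGraph (N : SimpleGraph V) : Prop :=
  ∀ ⦃u v w⦄, N.Adj u v → N.Adj u w → v = w

/-- Every edge of `G` has an end in `C`. -/
def Covers (G : SimpleGraph V) (C : Finset V) : Prop :=
  ∀ ⦃u v⦄, G.Adj u v → u ∈ C ∨ v ∈ C

theorem IsMatchingGraph.isAcyclic {N : SimpleGraph V} (hN : IsMatchingGraph N) : N.IsAcyclic := by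
  intro u p hp
  exact hp.snd_ne_penultimate (hN (p.adj_snd hp.not_nil) (p.adj_penultimate hp.not_nil).symm)

/-- Weak duality: sending each matching edge to one of its ends in `C` is injective, because
matching edges are disjoint. -/
theorem IsMatchingGraph.ncard_edgeSet_le [Fintype V] {G N : SimpleGraph V}
    (hN : IsMatchingGraph N) (hNG : N ≤ G) {C : Finset V} (hC : Covers G C) :
    N.edgeSet.ncard ≤ C.card := by
  classical
  have h : ∀ e ∈ N.edgeSet, ∃ v ∈ C, v ∈ e := by
    intro e
    induction e with
    | h u v =>
      intro he
      rcases hC (hNG he) with h | h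
      · exact ⟨u, h, by simp⟩
      · exact ⟨v, h, by simp⟩
  rcases isEmpty_or_nonempty V with hV | hV
  · simp [Set.eq_empty_of_isEmpty N.edgeSet]
  choose! f hfC hfe using h
  rw [← Set.ncard_coe_finset]
  refine Set.ncard_le_ncard_of_injOn f (fun e he => hfC e he) ?_ (Set.toFinite _)
  intro e he e' he' hee
  have h1 := hfe e he
  have h2 := hfe e' he'
  rw [← hee] at h2
  obtain ⟨a, ha⟩ := Sym2.mem_iff_exists.1 h1
  obtain ⟨b, hb⟩ := Sym2.mem_iff_exists.1 h2
  rw [ha] at he ⊢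
  rw [hb] at he' ⊢
  have hab : a = b := hN he he'
  rw [hab]

/-- The start of a longest path works: another neighbour would either extend the path or close a
cycle. -/
theorem exists_leaf [Finite V] {G : SimpleGraph V} (hG : G.IsAcyclic) {a b : V} (hab : G.Adj a b) :
    ∃ u v, G.Adj u v ∧ ∀ w, G.Adj u w → w = v := by
  have := Fintype.ofFinite V
  classical
  have : Nonempty V := ⟨a⟩
  have ⟨u, v, p, hp, hmax⟩ := Walk.exists_isPath_forall_isPath_length_le_length G
  have hnil : ¬p.Nil := by
    intro h
    have h1 := hmax _ _ (Walk.cons hab Walk.nil) (by simp [hab.ne])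
    rw [Walk.length_eq_zero_iff.2 h] at h1
    simp at h1
  refine ⟨u, p.snd, p.adj_snd hnil, fun w hadj ↦ ?_⟩
  apply hG.eq_snd_of_adj_start hp hadj
  have : ¬(p.cons hadj.symm).IsPath := by
    intro h
    have := hmax _ _ _ h
    simp at this
  grind [hp.cons]

/-- The inequality of König's theorem that needs an argument, for acyclic graphs. -/
theorem exists_matching_covers [Fintype V] :
    ∀ (k : ℕ) (G : SimpleGraph V), G.edgeSet.ncard ≤ k → G.IsAcyclic →
      ∃ N ≤ G, IsMatchingGraph N ∧ ∃ C : Finset V, Covers G C ∧ C.card ≤ N.edgeSet.ncard := by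
  classical
  intro k
  induction k with
  | zero =>
    intro G hk _
    have : G = ⊥ := by
      rw [← edgeSet_eq_empty]
      exact (Set.ncard_eq_zero (Set.toFinite _)).1 (by omega)
    subst this
    exact ⟨⊥, le_rfl, by intro u v w h; simp at h, ∅, by intro u v h; simp at h, by simp⟩
  | succ k ih =>
    intro G hk hG
    by_cases hb : ∃ a b, G.Adj a b
    · obtain ⟨a, b, hab⟩ := hb
      -- For a leaf `u` with neighbour `v`, the edge `uv` joins the matching and `v` joins the
      -- cover. Deleting all edges at `v` isolates `u` as well, so the matching found by induction
      -- avoids both.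
      obtain ⟨u, v, huv, hu⟩ := exists_leaf hG hab
      have hle : G.deleteIncidenceSet v ≤ G := deleteIncidenceSet_le G v
      obtain ⟨N, hNG, hN, C, hC, hCN⟩ := ih (G.deleteIncidenceSet v) (by
        have : (G.deleteIncidenceSet v).edgeSet.ncard < G.edgeSet.ncard := by
          apply Set.ncard_lt_ncard _ (Set.toFinite _)
          rw [edgeSet_ssubset_edgeSet]
          refine lt_of_le_of_ne hle ?_
          intro h
          have := huv
          rw [← h, deleteIncidenceSet_adj] at this
          exact this.2.2 rfl
        omega) (hG.anti hle)
      have hNv : ∀ w, ¬ N.Adj v w := by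
        intro w h
        have := hNG h
        rw [deleteIncidenceSet_adj] at this
        exact this.2.1 rfl
      have hNu : ∀ w, ¬ N.Adj u w := by
        intro w h
        have := hu w (hle (hNG h))
        subst this
        exact hNv _ h.symm
      have hadj : ∀ x y, (N ⊔ edge u v).Adj x y ↔
          N.Adj x y ∨ (x = u ∧ y = v) ∨ (x = v ∧ y = u) := by
        intro x y
        rw [sup_adj, edge_adj]
        have := huv.ne
        grind
      refine ⟨N ⊔ edge u v, ?_, ?_, insert v C, ?_, ?_⟩
      · intro x y h
        rcases (hadj x y).1 h with h | ⟨rfl, rfl⟩ | ⟨rfl, rfl⟩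
        · exact hle (hNG h)
        · exact huv
        · exact huv.symm
      · intro x y z hxy hxz
        rw [hadj] at hxy hxz
        have := huv.ne
        rcases hxy with h1 | ⟨rfl, rfl⟩ | ⟨rfl, rfl⟩ <;>
          rcases hxz with h2 | ⟨h2, h3⟩ | ⟨h2, h3⟩ <;> first
          | exact hN h1 h2
          | grind
      · intro x y h
        by_cases hx : x = v
        · simp [hx]
        by_cases hy : y = v
        · simp [hy]
        have := hC ((deleteIncidenceSet_adj).2 ⟨h, hx, hy⟩)
        simp only [Finset.mem_insert]
        tauto
      · have : (N ⊔ edge u v).edgeSet = insert s(u, v) N.edgeSet := by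
          ext e
          induction e with
          | h x y =>
            rw [mem_edgeSet, hadj, Set.mem_insert_iff, mem_edgeSet, Sym2.eq_iff]
            tauto
        have hmem : s(u, v) ∉ N.edgeSet := fun h => hNu v h
        rw [this, Set.ncard_insert_of_notMem hmem (Set.toFinite _)]
        exact (Finset.card_insert_le _ _).trans (by omega)
    · refine ih G ?_ hG
      have : G = ⊥ := by
        ext a b
        simp only [bot_adj, iff_false]
        exact fun h => hb ⟨a, b, h⟩
      simp [this]

variable [Fintype V]

theorem bddAbove_matching (G : SimpleGraph V) :
    BddAbove {k : ℕ | ∃ M : G.Subgraph, M.IsMatching ∧ M.edgeSet.ncard = k} := by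
  refine ⟨G.edgeSet.ncard, ?_⟩
  rintro k ⟨M, -, rfl⟩
  exact Set.ncard_le_ncard M.edgeSet_subset (Set.toFinite _)

theorem IsMatchingGraph.ncard_le_matchingNumber {G N : SimpleGraph V} (hN : IsMatchingGraph N)
    (hNG : N ≤ G) : N.edgeSet.ncard ≤ matchingNumber G := by
  refine le_csSup (bddAbove_matching G) ⟨⟨N.support, N.Adj, fun h => hNG h,
    fun h => ⟨_, h⟩, N.symm⟩, ?_, ?_⟩
  · rintro v ⟨w, hw⟩
    exact ⟨w, hw, fun y hy => hN hy hw⟩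
  · congr 1

theorem exists_matchingGraph (G : SimpleGraph V) :
    ∃ N ≤ G, IsMatchingGraph N ∧ N.edgeSet.ncard = matchingNumber G := by
  have hne : {k : ℕ | ∃ M : G.Subgraph, M.IsMatching ∧ M.edgeSet.ncard = k}.Nonempty :=
    ⟨0, ⊥, by rintro v hv; simp at hv, by simp⟩
  obtain ⟨M, hM, hk⟩ := Nat.sSup_mem hne (bddAbove_matching G)
  refine ⟨M.spanningCoe, M.spanningCoe_le, fun u v w h1 h2 => hM.eq_of_adj_left h1 h2, ?_⟩
  rw [Subgraph.edgeSet_spanningCoe]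
  exact hk

theorem matchingNumber_mono {G H : SimpleGraph V} (h : G ≤ H) :
    matchingNumber G ≤ matchingNumber H := by
  obtain ⟨N, hNG, hN, hk⟩ := exists_matchingGraph G
  exact hk ▸ hN.ncard_le_matchingNumber (hNG.trans h)

theorem Covers.matchingNumber_le {G : SimpleGraph V} {C : Finset V} (hC : Covers G C) :
    matchingNumber G ≤ C.card := by
  obtain ⟨N, hNG, hN, hk⟩ := exists_matchingGraph G
  exact hk ▸ hN.ncard_edgeSet_le hNG hC

/-- The cover is padded to size exactly `k`, so that later counts may use `|C| = 4`. -/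
theorem exists_covers_card_eq {G : SimpleGraph V} (hG : G.IsAcyclic) {k : ℕ}
    (hk : matchingNumber G ≤ k) (hV : k ≤ Fintype.card V) :
    ∃ C : Finset V, Covers G C ∧ C.card = k := by
  obtain ⟨N, hNG, hN, C, hC, hCN⟩ := exists_matching_covers _ G le_rfl hG
  obtain ⟨D, hCD, hD⟩ := Finset.exists_superset_card_eq
    (hCN.trans ((hN.ncard_le_matchingNumber hNG).trans hk)) hV
  exact ⟨D, fun u v h => (hC h).imp (@hCD _) (@hCD _), hD⟩

theorem matchingNumber_eq_of_cover {G : SimpleGraph V} {k : ℕ} {f g : Fin k → V}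
    (hf : f.Injective) (hg : g.Injective) (hfg : ∀ i j, f i ≠ g j)
    (hadj : ∀ i, G.Adj (f i) (g i)) (hcov : ∀ u v, G.Adj u v → (∃ i, u = f i) ∨ ∃ i, v = f i) :
    matchingNumber G = k := by
  classical
  apply le_antisymm
  · have hC : Covers G (Finset.univ.image f) := by
      intro u v h
      simpa [eq_comm] using hcov u v h
    exact hC.matchingNumber_le.trans (Finset.card_image_le.trans (by simp))
  · let N : SimpleGraph V :=
      { Adj := fun x y => ∃ i, (x = f i ∧ y = g i) ∨ (x = g i ∧ y = f i)
        symm := ⟨by rintro x y ⟨i, h⟩; exact ⟨i, by tauto⟩⟩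
        loopless := ⟨by rintro x ⟨i, ⟨h, h'⟩ | ⟨h, h'⟩⟩ <;> exact hfg i i (by rw [← h, ← h'])⟩ }
    have hN : IsMatchingGraph N := by
      rintro u v w ⟨i, ⟨rfl, rfl⟩ | ⟨rfl, rfl⟩⟩ ⟨j, ⟨h, rfl⟩ | ⟨h, rfl⟩⟩
      · rw [hf h]
      · exact (hfg _ _ h).elim
      · exact (hfg _ _ h.symm).elim
      · rw [hg h]
    have hNG : N ≤ G := by
      rintro u v ⟨i, ⟨rfl, rfl⟩ | ⟨rfl, rfl⟩⟩
      · exact hadj i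
      · exact (hadj i).symm
    refine le_trans ?_ (hN.ncard_le_matchingNumber hNG)
    have := Set.ncard_le_ncard_of_injOn (s := (Set.univ : Set (Fin k))) (t := N.edgeSet)
      (fun i => s(f i, g i)) (fun i _ => ⟨i, Or.inl ⟨rfl, rfl⟩⟩) (by
        intro i _ j _ h
        rcases Sym2.eq_iff.1 h with h | h
        · exact hf h.1
        · exact (hfg _ _ h.1).elim) (Set.toFinite _)
    simpa using this

end Matching

/-! ### Rayleigh quotients, positive eigenvectors and strict monotonicity of the spectral radius -/

section Spectral

open Classical in
theorem adjMatrix_mulVec_eq {V : Type*} [Fintype V] (G : SimpleGraph V) (x : V → ℝ) (v : V) :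
    ((G.adjMatrix ℝ).mulVec x) v = ∑ w, if G.Adj v w then x w else 0 := by
  simp [Matrix.mulVec, dotProduct, adjMatrix_apply]

open Classical in
theorem isHermitian_adjMatrix {V : Type*} (G : SimpleGraph V) : (G.adjMatrix ℝ).IsHermitian := by
  rw [Matrix.IsHermitian, Matrix.conjTranspose_eq_transpose_of_trivial]
  exact G.isSymm_adjMatrix

variable {V : Type*} [Fintype V]

open Classical in
theorem rho_mem_spectrum [Nonempty V] (G : SimpleGraph V) :
    rho G ∈ spectrum ℝ (G.adjMatrix ℝ) := by
  apply Set.Nonempty.csSup_mem _ (Matrix.finite_real_spectrum)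
  exact ⟨_, (isHermitian_adjMatrix G).eigenvalues_mem_spectrum_real (Classical.arbitrary V)⟩

open Classical in
theorem exists_eigenvector_rho [Nonempty V] (G : SimpleGraph V) :
    ∃ x : V → ℝ, x ≠ 0 ∧ (G.adjMatrix ℝ).mulVec x = rho G • x := by
  have h := rho_mem_spectrum G
  rw [← Matrix.spectrum_toLin', ← Module.End.hasEigenvalue_iff_mem_spectrum] at h
  obtain ⟨x, hx⟩ := h.exists_hasEigenvector
  exact ⟨x, hx.2, by simpa using hx.apply_eq_smul⟩

open Classical in
theorem posSemidef_rho_sub (G : SimpleGraph V) :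
    (algebraMap ℝ (Matrix V V ℝ) (rho G) - G.adjMatrix ℝ).PosSemidef := by
  rw [Matrix.posSemidef_iff_isHermitian_and_spectrum_nonneg]
  refine ⟨?_, ?_⟩
  · refine Matrix.IsHermitian.sub ?_ (isHermitian_adjMatrix G)
    rw [Matrix.algebraMap_eq_diagonal]
    exact Matrix.isHermitian_diagonal _
  · intro a ha
    rw [← spectrum.singleton_sub_eq] at ha
    obtain ⟨_, rfl, b, hb, rfl⟩ := Set.mem_sub.1 ha
    simp only [Set.mem_ofPred_eq, sub_nonneg]
    exact le_csSup (Matrix.finite_real_spectrum).bddAbove hb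

open Classical in
theorem rho_sub_form (G : SimpleGraph V) (x : V → ℝ) :
    x ⬝ᵥ (algebraMap ℝ (Matrix V V ℝ) (rho G) - G.adjMatrix ℝ).mulVec x =
      rho G * ∑ v, x v ^ 2 - ∑ v, ∑ w, if G.Adj v w then x v * x w else 0 := by
  rw [Matrix.sub_mulVec, dotProduct_sub]
  congr 1
  · rw [Algebra.algebraMap_eq_smul_one, Matrix.smul_mulVec, Matrix.one_mulVec, dotProduct_smul]
    simp [dotProduct, sq]
  · simp only [dotProduct, adjMatrix_mulVec_eq, Finset.mul_sum, mul_ite, mul_zero]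

open Classical in
theorem rayleigh_le (G : SimpleGraph V) (x : V → ℝ) :
    ∑ v, ∑ w, (if G.Adj v w then x v * x w else 0) ≤ rho G * ∑ v, x v ^ 2 := by
  have := (posSemidef_rho_sub G).dotProduct_mulVec_nonneg x
  rw [star_trivial, rho_sub_form] at this
  linarith

theorem rho_nonneg [Nonempty V] (G : SimpleGraph V) : 0 ≤ rho G := by
  classical
  have h := rayleigh_le G fun _ => 1
  have h0 : 0 ≤ ∑ v : V, ∑ w, (if G.Adj v w then (1 : ℝ) * 1 else 0) :=
    Finset.sum_nonneg fun _ _ => Finset.sum_nonneg fun _ _ => by split_ifs <;> norm_num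
  have hpos : 0 < ∑ v : V, (1 : ℝ) ^ 2 := Finset.sum_pos (fun _ _ => by norm_num) Finset.univ_nonempty
  exact nonneg_of_mul_nonneg_left (h0.trans h) hpos

-- Collatz–Wielandt bound: for an eigenvector `x` of `rho G`, evaluate the eigenvalue equation at a
-- vertex where `|x v| / y v` is largest.
open Classical in
theorem rho_le_of_supersolution [Nonempty V] (G : SimpleGraph V) (y : V → ℝ) (t : ℝ)
    (hy : ∀ v, 0 < y v) (h : ∀ v, ∑ w, (if G.Adj v w then y w else 0) ≤ t * y v) :
    rho G ≤ t := by
  obtain ⟨x, hx0, hx⟩ := exists_eigenvector_rho G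
  obtain ⟨v, -, hv⟩ := Finset.exists_max_image Finset.univ (fun v => |x v| / y v) ⟨Classical.arbitrary V, by simp⟩
  set m := |x v| / y v with hm
  have hle : ∀ w, |x w| ≤ m * y w := fun w => by
    have := hv w (by simp)
    rwa [div_le_iff₀ (hy w)] at this
  have hxv : |x v| = m * y v := by rw [hm, div_mul_cancel₀ _ (hy v).ne']
  have hmpos : 0 < m := by
    obtain ⟨w, hw⟩ : ∃ w, x w ≠ 0 := by
      by_contra hcon
      push Not at hcon
      exact hx0 (funext hcon)
    by_contra hcon
    have := hle w
    have := mul_nonpos_of_nonpos_of_nonneg (not_lt.1 hcon) (hy w).le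
    have := abs_pos.2 hw
    linarith
  have hev := congrFun hx v
  rw [adjMatrix_mulVec_eq, Pi.smul_apply, smul_eq_mul] at hev
  have h1 : rho G * |x v| ≤ ∑ w, if G.Adj v w then m * y w else 0 := by
    calc rho G * |x v| ≤ |rho G * x v| := by
          rw [abs_mul]
          exact mul_le_mul_of_nonneg_right (le_abs_self _) (abs_nonneg _)
      _ = |∑ w, if G.Adj v w then x w else 0| := by rw [hev]
      _ ≤ ∑ w, |if G.Adj v w then x w else 0| := Finset.abs_sum_le_sum_abs _ _
      _ ≤ _ := by
          apply Finset.sum_le_sum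
          intro w _
          split_ifs
          · exact hle w
          · simp
  have h2 : ∑ w, (if G.Adj v w then m * y w else 0) = m * ∑ w, if G.Adj v w then y w else 0 := by
    rw [Finset.mul_sum]
    simp
  rw [h2, hxv] at h1
  have h3 := mul_le_mul_of_nonneg_left (h v) hmpos.le
  have h4 : rho G * (m * y v) ≤ t * (m * y v) := by linarith
  exact le_of_mul_le_mul_right h4 (mul_pos hmpos (hy v))

-- The part of Perron–Frobenius that is needed. Taking absolute values of an eigenvector cannot
-- lower the quadratic form, so the result is again maximal and lies in the kernel of the positive
-- semidefinite matrix `ρ - A`. A zero entry would then force zeros at all neighbours, hence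
-- everywhere by connectedness.
open Classical in
theorem exists_pos_maximizer {G : SimpleGraph V} (hG : G.Connected) :
    ∃ z : V → ℝ, (∀ v, 0 < z v) ∧
      ∑ v, ∑ w, (if G.Adj v w then z v * z w else 0) = rho G * ∑ v, z v ^ 2 := by
  have := hG.nonempty
  obtain ⟨x, hx0, hx⟩ := exists_eigenvector_rho G
  set z : V → ℝ := fun v => |x v| with hz
  have hform : ∑ v, ∑ w, (if G.Adj v w then x v * x w else 0) = rho G * ∑ v, x v ^ 2 := by
    have := congrArg (fun y => x ⬝ᵥ y) hx
    simp only [dotProduct, adjMatrix_mulVec_eq, Finset.mul_sum, mul_ite, mul_zero] at this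
    rw [this, Finset.mul_sum]
    exact Finset.sum_congr rfl fun v _ => by rw [Pi.smul_apply, smul_eq_mul]; ring
  have hsq : ∑ v, z v ^ 2 = ∑ v, x v ^ 2 := by simp [hz]
  have hge : ∑ v, ∑ w, (if G.Adj v w then x v * x w else 0) ≤
      ∑ v, ∑ w, (if G.Adj v w then z v * z w else 0) := by
    refine Finset.sum_le_sum fun v _ => Finset.sum_le_sum fun w _ => ?_
    split_ifs
    · simp only [hz, ← abs_mul]
      exact le_abs_self _
    · rfl
  have heq : ∑ v, ∑ w, (if G.Adj v w then z v * z w else 0) = rho G * ∑ v, z v ^ 2 := by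
    apply le_antisymm (rayleigh_le G z)
    rw [hsq, ← hform]
    exact hge
  refine ⟨z, ?_, heq⟩
  have hker := ((posSemidef_rho_sub G).dotProduct_mulVec_zero_iff z).1 (by
    rw [star_trivial, rho_sub_form, heq, sub_self])
  have hev : ∀ v, ∑ w, (if G.Adj v w then z w else 0) = rho G * z v := by
    intro v
    have := congrFun hker v
    rw [Matrix.sub_mulVec, Pi.sub_apply, adjMatrix_mulVec_eq, Algebra.algebraMap_eq_smul_one,
      Matrix.smul_mulVec, Matrix.one_mulVec] at this
    simp only [Pi.smul_apply, smul_eq_mul, Pi.zero_apply] at this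
    linarith
  have hstep : ∀ v w, G.Adj v w → z v = 0 → z w = 0 := by
    intro v w hvw hv
    have h0 := hev v
    rw [hv, mul_zero, Finset.sum_eq_zero_iff_of_nonneg (fun w _ => by
      split_ifs
      · exact abs_nonneg _
      · rfl)] at h0
    simpa [hvw] using h0 w (by simp)
  by_contra hcon
  push Not at hcon
  obtain ⟨v, hv⟩ := hcon
  have hv0 : z v = 0 := le_antisymm hv (abs_nonneg _)
  apply hx0
  ext w
  obtain ⟨p⟩ := hG.preconnected v w
  have : z w = 0 := by
    clear hv
    induction p with
    | nil => exact hv0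
    | cons h p ih => exact ih (hstep _ _ h hv0)
  simpa [hz] using this

theorem rho_lt_of_lt {G H : SimpleGraph V} (hG : G.Connected) (h : G < H) : rho G < rho H := by
  classical
  obtain ⟨z, hz, heq⟩ := exists_pos_maximizer hG
  have := hG.nonempty
  obtain ⟨a, b, hab, hab'⟩ : ∃ a b, H.Adj a b ∧ ¬ G.Adj a b := by
    by_contra hcon
    push Not at hcon
    exact not_le_of_gt h (fun a b hab => hcon a b hab)
  have hterm : ∀ v w, (if G.Adj v w then z v * z w else 0) ≤ if H.Adj v w then z v * z w else 0 := by
    intro v w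
    by_cases hG' : G.Adj v w
    · simp [hG', h.le hG']
    · simp only [hG', if_false]
      split_ifs
      · exact (mul_pos (hz v) (hz w)).le
      · rfl
  have hlt : ∑ v, ∑ w, (if G.Adj v w then z v * z w else 0) <
      ∑ v, ∑ w, (if H.Adj v w then z v * z w else 0) := by
    refine Finset.sum_lt_sum (fun v _ => Finset.sum_le_sum fun w _ => hterm v w) ⟨a, by simp, ?_⟩
    refine Finset.sum_lt_sum (fun w _ => hterm a w) ⟨b, by simp, ?_⟩
    simp [hab, hab', mul_pos (hz a) (hz b)]
  have hle := rayleigh_le H z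
  have hpos : 0 < ∑ v, z v ^ 2 :=
    Finset.sum_pos (fun v _ => pow_pos (hz v) 2) Finset.univ_nonempty
  rw [heq] at hlt
  exact lt_of_mul_lt_mul_right (hlt.trans_le hle) hpos.le

end Spectral

/-- A maximum matching is acyclic, so it extends to a spanning tree with the same matching number;
were that tree a proper subgraph, its spectral radius would be smaller. -/
theorem IsMinimizer.isTree {n β : ℕ} {T : SimpleGraph (Fin n)} (hT : IsMinimizer n β T) :
    T.IsTree := by
  obtain ⟨⟨hconn, hβ⟩, hmin⟩ := hT
  obtain ⟨N, hNT, hN, hk⟩ := exists_matchingGraph T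
  obtain ⟨F, hNF, hFT, hF⟩ := hconn.exists_isTree_le_of_le_of_isAcyclic hNT hN.isAcyclic
  rcases hFT.eq_or_lt with rfl | hlt
  · exact hF
  · have hmem : F ∈ family n β := by
      refine ⟨hF.connected, le_antisymm (hβ ▸ matchingNumber_mono hFT) ?_⟩
      rw [← hβ, ← hk]
      exact hN.ncard_le_matchingNumber hNF
    exact absurd (hmin F hmem) (not_le_of_gt (rho_lt_of_lt hF.connected hlt))

/-! ### Lower bound for the spectral radius from a cover of four vertices -/

section LowerBound

variable {V : Type*}

open Classical in
/-- The number of ordered adjacent pairs inside `C`. -/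
noncomputable def innerSum (G : SimpleGraph V) (C : Finset V) : ℝ :=
  ∑ v ∈ C, ∑ w ∈ C, if G.Adj v w then 1 else 0

open Classical in
/-- The number of neighbours in `C` of the vertex `u`. -/
noncomputable def degIn (G : SimpleGraph V) (C : Finset V) (u : V) : ℝ :=
  ∑ w ∈ C, if G.Adj u w then 1 else 0

theorem innerSum_nonneg (G : SimpleGraph V) (C : Finset V) : 0 ≤ innerSum G C :=
  Finset.sum_nonneg fun _ _ => Finset.sum_nonneg fun _ _ => by split_ifs <;> norm_num

open Classical in
theorem degIn_eq_card (G : SimpleGraph V) (C : Finset V) (u : V) :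
    degIn G C u = ((C.filter (G.Adj u)).card : ℝ) := by
  simp [degIn]

theorem two_le_innerSum {G : SimpleGraph V} {C : Finset V} {a b : V} (ha : a ∈ C) (hb : b ∈ C)
    (hab : G.Adj a b) : 2 ≤ innerSum G C := by
  classical
  have hnn : ∀ v w, (0 : ℝ) ≤ if G.Adj v w then 1 else 0 := fun v w => by split_ifs <;> norm_num
  have h1 : ∀ x y, y ∈ C → G.Adj x y → (1 : ℝ) ≤ ∑ w ∈ C, if G.Adj x w then 1 else 0 := by
    intro x y hy hxy
    have := Finset.single_le_sum (f := fun w => if G.Adj x w then (1 : ℝ) else 0)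
      (fun w _ => hnn x w) hy
    simpa [hxy] using this
  have h2 : ({a, b} : Finset V) ⊆ C := by
    intro x hx
    simp only [Finset.mem_insert, Finset.mem_singleton] at hx
    rcases hx with rfl | rfl <;> assumption
  have h3 := Finset.sum_le_sum_of_subset_of_nonneg
    (f := fun x => ∑ w ∈ C, if G.Adj x w then (1 : ℝ) else 0) h2
    (fun x _ _ => Finset.sum_nonneg fun w _ => hnn x w)
  rw [Finset.sum_pair hab.ne] at h3
  have := h1 a b hb hab
  have := h1 b a ha hab.symm
  unfold innerSum
  linarith

theorem degIn_pos {G : SimpleGraph V} (hG : G.Connected) {C : Finset V} (hC : Covers G C)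
    (hne : C.Nonempty) {u : V} (hu : u ∉ C) : 1 ≤ degIn G C u := by
  classical
  rw [degIn_eq_card, Nat.one_le_cast, Nat.one_le_iff_ne_zero, Finset.card_ne_zero]
  obtain ⟨c, hc⟩ := hne
  have : Nontrivial V := ⟨u, c, fun h => hu (h ▸ hc)⟩
  obtain ⟨w, hw⟩ := hG.preconnected.exists_adj_of_nontrivial u
  exact ⟨w, by simpa [hw] using (hC hw).resolve_left hu⟩

variable [Fintype V]

open Classical in
theorem sum_form_of_covers {G : SimpleGraph V} {C : Finset V} (hC : Covers G C) (t : ℝ) (y : V → ℝ) :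
    ∑ v, ∑ w, (if G.Adj v w then
        (if v ∈ C then t else y v) * (if w ∈ C then t else y w) else 0) =
      t ^ 2 * innerSum G C + 2 * t * ∑ u ∈ Cᶜ, degIn G C u * y u := by
  have h1 : ∀ f : V → V → ℝ, ∑ v, ∑ w, f v w = ∑ v ∈ C, ∑ w ∈ C, f v w + ∑ v ∈ C, ∑ w ∈ Cᶜ, f v w
      + (∑ v ∈ Cᶜ, ∑ w ∈ C, f v w + ∑ v ∈ Cᶜ, ∑ w ∈ Cᶜ, f v w) := by
    intro f
    rw [← Finset.sum_add_sum_compl C, ← Finset.sum_add_distrib, ← Finset.sum_add_distrib]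
    simp only [Finset.sum_add_sum_compl]
  rw [h1]
  have h2 : ∑ v ∈ C, ∑ w ∈ C, (if G.Adj v w then
        (if v ∈ C then t else y v) * (if w ∈ C then t else y w) else 0) = t ^ 2 * innerSum G C := by
    rw [innerSum, Finset.mul_sum]
    refine Finset.sum_congr rfl fun v hv => ?_
    rw [Finset.mul_sum]
    refine Finset.sum_congr rfl fun w hw => ?_
    simp [hv, hw, sq]
  have h3 : ∑ v ∈ Cᶜ, ∑ w ∈ C, (if G.Adj v w then
        (if v ∈ C then t else y v) * (if w ∈ C then t else y w) else 0) =
        t * ∑ u ∈ Cᶜ, degIn G C u * y u := by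
    rw [Finset.mul_sum]
    refine Finset.sum_congr rfl fun v hv => ?_
    rw [degIn, Finset.sum_mul, Finset.mul_sum]
    refine Finset.sum_congr rfl fun w hw => ?_
    simp [Finset.mem_compl.1 hv, hw, mul_comm]
  have h4 : ∑ v ∈ C, ∑ w ∈ Cᶜ, (if G.Adj v w then
        (if v ∈ C then t else y v) * (if w ∈ C then t else y w) else 0) =
        t * ∑ u ∈ Cᶜ, degIn G C u * y u := by
    rw [Finset.sum_comm, ← h3]
    refine Finset.sum_congr rfl fun v _ => Finset.sum_congr rfl fun w _ => ?_
    simp only [G.adj_comm w v, mul_comm]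
  have h5 : ∑ v ∈ Cᶜ, ∑ w ∈ Cᶜ, (if G.Adj v w then
        (if v ∈ C then t else y v) * (if w ∈ C then t else y w) else 0) = 0 := by
    refine Finset.sum_eq_zero fun v hv => Finset.sum_eq_zero fun w hw => if_neg fun h => ?_
    exact (hC h).elim (Finset.mem_compl.1 hv) (Finset.mem_compl.1 hw)
  rw [h2, h3, h4, h5]
  ring

-- Twice the number of edges, computed by evaluating `sum_form_of_covers` at the all-ones vector.
open Classical in
theorem sum_degIn_of_isTree {G : SimpleGraph V} (hG : G.IsTree) {C : Finset V} (hC : Covers G C) :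
    innerSum G C + 2 * ∑ u ∈ Cᶜ, degIn G C u = 2 * ((Fintype.card V : ℝ) - 1) := by
  have h := sum_form_of_covers hC 1 (fun _ => 1)
  have h1 := G.sum_degrees_eq_twice_card_edges
  have h2 := hG.card_edgeFinset
  have h3 : ∑ v, ∑ w, (if G.Adj v w then (1 : ℝ) else 0) = ((∑ v, G.degree v : ℕ) : ℝ) := by
    push_cast
    refine Finset.sum_congr rfl fun v _ => ?_
    rw [Finset.sum_boole, ← card_neighborFinset_eq_degree, neighborFinset_eq_filter]
  simp only [ite_self, mul_one, one_pow, one_mul] at h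
  rw [← h, h3, h1, ← h2]
  push_cast
  ring

open Classical in
theorem rayleigh_covers {G : SimpleGraph V} {C : Finset V} (hC : Covers G C) (t : ℝ) :
    t ^ 2 * innerSum G C + 2 * t * ∑ u ∈ Cᶜ, degIn G C u ^ 2 ≤
      rho G * (C.card * t ^ 2 + ∑ u ∈ Cᶜ, degIn G C u ^ 2) := by
  have h := rayleigh_le G (fun v => if v ∈ C then t else degIn G C v)
  rw [sum_form_of_covers hC t] at h
  have h1 : ∑ v, (if v ∈ C then t else degIn G C v) ^ 2 =
      C.card * t ^ 2 + ∑ u ∈ Cᶜ, degIn G C u ^ 2 := by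
    rw [← Finset.sum_add_sum_compl C]
    congr 1
    · rw [Finset.sum_congr rfl fun v hv => by rw [if_pos hv]]
      simp
    · exact Finset.sum_congr rfl fun v hv => by rw [if_neg (Finset.mem_compl.1 hv)]
  rw [h1] at h
  simpa only [sq] using h

open Classical in
/-- A lower bound for the spectral radius of a tree with a vertex cover of four vertices that is
not the subdivision of a tree with additional pendant vertices. -/
theorem le_four_mul_rho_sq {G : SimpleGraph V} (hG : G.IsTree) {C : Finset V} (hC : Covers G C)
    (hcard : C.card = 4) (hV : 11 ≤ Fintype.card V)
    (hbad : (∃ a ∈ C, ∃ b ∈ C, G.Adj a b) ∨ ∃ u ∉ C, 3 ≤ (C.filter (G.Adj u)).card) :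
    (Fintype.card V : ℝ) + 6 ≤ 4 * rho G ^ 2 := by
  have hne : C.Nonempty := Finset.card_pos.1 (by omega)
  set n : ℝ := (Fintype.card V : ℝ) with hn
  have hn11 : (11 : ℝ) ≤ n := by rw [hn]; exact_mod_cast hV
  set ρ := rho G
  set E := innerSum G C with hE
  have hE0 : 0 ≤ E := innerSum_nonneg G C
  set S := ∑ u ∈ Cᶜ, degIn G C u ^ 2 with hS
  have hsum := sum_degIn_of_isTree hG hC
  have hd : ∀ u ∈ Cᶜ, 1 ≤ degIn G C u := fun u hu =>
    degIn_pos hG.connected hC hne (Finset.mem_compl.1 hu)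
  have hcc : ((Cᶜ : Finset V).card : ℝ) = n - 4 := by
    rw [Finset.card_compl, hcard, Nat.cast_sub (by omega)]
    norm_num [hn]
  -- Every vertex outside `C` uses at least one of the `n - 1` edges, which leaves at most three
  -- inside `C`.
  have hE6 : E ≤ 6 := by
    have : ((Cᶜ : Finset V).card : ℝ) ≤ ∑ u ∈ Cᶜ, degIn G C u := by
      rw [← nsmul_one, ← Finset.sum_const]
      exact Finset.sum_le_sum hd
    linarith
  have hSge1 : n - 4 ≤ S := by
    rw [← hcc, ← nsmul_one, ← Finset.sum_const]
    exact Finset.sum_le_sum fun u hu => one_le_pow₀ (hd u hu)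
  have hray : ∀ t : ℝ, t ^ 2 * E + 2 * t * S ≤ ρ * (4 * t ^ 2 + S) := by
    intro t
    have := rayleigh_covers hC t
    rw [hcard] at this
    exact_mod_cast this
  have hρ : 0 < ρ := by
    have := hray 1
    by_contra hcon
    have := mul_nonpos_of_nonpos_of_nonneg (not_lt.1 hcon) (by linarith : 0 ≤ 4 * (1 : ℝ) ^ 2 + S)
    linarith
  -- With `t = ρ` the test vector satisfies the eigenvalue equation at every vertex outside `C`,
  -- since all its neighbours lie in `C`.
  have hmain : ρ * E + S ≤ 4 * ρ ^ 2 := by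
    have h1 := hray ρ
    have : ρ * (ρ * E + S) ≤ ρ * (4 * ρ ^ 2) := by nlinarith
    exact le_of_mul_le_mul_left this hρ
  -- The polynomial `(d - 1)(d - 2)` vanishes at the two allowed degrees and is nonnegative at every
  -- positive integer. It bounds `S` below through the known value of `∑ d`.
  have hexp : S - 3 * ∑ u ∈ Cᶜ, degIn G C u + 2 * (n - 4) =
      ∑ u ∈ Cᶜ, (degIn G C u - 1) * (degIn G C u - 2) := by
    rw [← hcc, hS, Finset.mul_sum, ← Finset.sum_sub_distrib, mul_comm 2, ← nsmul_eq_mul,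
      ← Finset.sum_const, ← Finset.sum_add_distrib]
    exact Finset.sum_congr rfl fun u _ => by ring
  have hterm : ∀ u ∈ Cᶜ, 0 ≤ (degIn G C u - 1) * (degIn G C u - 2) := by
    intro u hu
    rw [degIn_eq_card]
    rcases Nat.lt_or_ge (C.filter (G.Adj u)).card 2 with h | h
    · have h1 := hd u hu
      rw [degIn_eq_card, Nat.one_le_cast] at h1
      have : (C.filter (G.Adj u)).card = 1 := by omega
      simp [this]
    · have : (2 : ℝ) ≤ (C.filter (G.Adj u)).card := by exact_mod_cast h
      apply mul_nonneg <;> linarith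
  have hsumnn := Finset.sum_nonneg hterm
  have hbase : n + 5 + E * (ρ - 3 / 2) ≤ 4 * ρ ^ 2 := by nlinarith
  by_cases hE2 : ∃ a ∈ C, ∃ b ∈ C, G.Adj a b
  · obtain ⟨a, ha, b, hb, hab⟩ := hE2
    have hE2 : 2 ≤ E := two_le_innerSum ha hb hab
    have hρ2 : 2 ≤ ρ := by
      by_contra hcon
      push Not at hcon
      rcases le_or_gt (3 / 2) ρ with h | h
      · nlinarith [mul_nonneg hE0 (sub_nonneg.2 h)]
      · nlinarith [mul_nonneg (sub_nonneg.2 hE6) (sub_nonneg.2 h.le)]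
    nlinarith
  · obtain ⟨u, hu, hu3⟩ := hbad.resolve_left hE2
    have hE0' : E = 0 := by
      rw [hE, innerSum]
      refine Finset.sum_eq_zero fun v hv => Finset.sum_eq_zero fun w hw => if_neg fun h => ?_
      exact hE2 ⟨v, hv, w, hw, h⟩
    -- A vertex with `d ≥ 3` contributes `(d - 1)(d - 2) ≥ 2`, so here even `n + 7 ≤ 4ρ²`.
    have h2 := Finset.single_le_sum hterm (Finset.mem_compl.2 hu)
    have h3 : (3 : ℝ) ≤ degIn G C u := by
      rw [degIn_eq_card]
      exact_mod_cast hu3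
    rw [← hE, hE0'] at hsum
    rw [hE0'] at hmain
    nlinarith

end LowerBound

/-! ### A comparison tree with small spectral radius -/

section Reference

theorem connected_K6 (a b c d : ℕ) : (K6 a b c d).Connected := by
  have hadj : ∀ i j : Fin 7, s(i, j) ∈ ({s(0, 4), s(4, 1), s(1, 5), s(5, 2), s(2, 6), s(6, 3)} :
      Set (Sym2 (Fin 7))) → i ≠ j → (K6 a b c d).Reachable (.inl i) (.inl j) := by
    intro i j h hij
    exact Adj.reachable (show (fromEdgeSet _).Adj i j from (fromEdgeSet_adj _).2 ⟨h, hij⟩)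
  have h04 := hadj 0 4 (by simp) (by decide)
  have h41 := hadj 4 1 (by simp) (by decide)
  have h15 := hadj 1 5 (by simp) (by decide)
  have h52 := hadj 5 2 (by simp) (by decide)
  have h26 := hadj 2 6 (by simp) (by decide)
  have h63 := hadj 6 3 (by simp) (by decide)
  have hinl : ∀ i : Fin 7, (K6 a b c d).Reachable (.inl 0) (.inl i) := by
    have h01 := h04.trans h41
    have h05 := h01.trans h15
    have h02 := h05.trans h52
    have h06 := h02.trans h26
    have h03 := h06.trans h63
    intro i
    fin_cases i
    exacts [Reachable.refl _, h01, h02, h03, h04, h05, h06]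
  rw [connected_iff_exists_forall_reachable]
  refine ⟨.inl 0, ?_⟩
  rintro (i | p)
  · exact hinl i
  · refine (hinl (![0, 1, 2, 3] p.1)).trans (Adj.reachable ?_)
    exact rfl

theorem matchingNumber_comap_K6 {V : Type*} [Fintype V] {a b c d : ℕ} (ha : 1 ≤ a)
    (e : V ≃ Fin 7 ⊕ ((i : Fin 4) × Fin (![a, b, c, d] i))) :
    matchingNumber ((K6 a b c d).comap e) = 4 := by
  -- The cover `v₁, …, v₄` is matched with a pendant vertex of `v₁` and with `u₁, u₂, u₃`; hence the
  -- need for `1 ≤ a`.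
  let f : Fin 4 → Fin 7 ⊕ ((i : Fin 4) × Fin (![a, b, c, d] i)) :=
    ![.inl 0, .inl 1, .inl 2, .inl 3]
  let g : Fin 4 → Fin 7 ⊕ ((i : Fin 4) × Fin (![a, b, c, d] i)) :=
    ![.inr ⟨0, ⟨0, ha⟩⟩, .inl 4, .inl 5, .inl 6]
  refine matchingNumber_eq_of_cover (f := e.symm ∘ f) (g := e.symm ∘ g)
    (e.symm.injective.comp ?_) (e.symm.injective.comp ?_) ?_ ?_ ?_
  · intro i j h
    fin_cases i <;> fin_cases j <;> simp [f] at h ⊢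
  · intro i j h
    fin_cases i <;> fin_cases j <;> simp [g] at h ⊢
  · intro i j h
    have h := e.symm.injective h
    fin_cases i <;> fin_cases j <;> simp [f, g] at h
  · intro i
    simp only [comap_adj, Function.comp_apply, Equiv.apply_symm_apply]
    fin_cases i <;> simp [f, g, K6, attachLeaves]
  · intro u v h
    simp only [comap_adj] at h
    simp only [Function.comp_apply, Equiv.eq_symm_apply]
    generalize e u = x at h ⊢
    generalize e v = y at h ⊢
    have hf : ∀ i : Fin 4, f i = .inl (![0, 1, 2, 3] i) := by
      intro i
      fin_cases i <;> rfl
    simp only [hf]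
    rcases x with i | p <;> rcases y with j | q
    · simp only [K6, attachLeaves, fromEdgeSet_adj] at h
      simp only [Sum.inl.injEq]
      revert h
      fin_cases i <;> fin_cases j <;> simp [Fin.exists_fin_succ]
    · exact Or.inl ⟨q.1, congrArg _ h⟩
    · exact Or.inr ⟨p.1, congrArg _ h⟩
    · exact h.elim

theorem rho_iso {V W : Type*} [Fintype V] [Fintype W] {G : SimpleGraph V} {H : SimpleGraph W}
    (e : G ≃g H) : rho G = rho H := by
  classical
  unfold rho
  rw [← AlgEquiv.spectrum_eq (Matrix.reindexAlgEquiv ℝ ℝ e.toEquiv) (G.adjMatrix ℝ)]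
  congr 2
  ext i j
  simp only [Matrix.coe_reindexAlgEquiv, Matrix.reindex_apply, Matrix.submatrix_apply,
    adjMatrix_apply]
  have : G.Adj (e.toEquiv.symm i) (e.toEquiv.symm j) ↔ H.Adj i j := e.symm.map_adj_iff
  simp only [this]

/-- Values `t * qᵢ` on the cover force the values elsewhere if equality is to hold at the pendant
and subdividing vertices. What remains is a system at the four cover vertices with `t ^ 2` in place
of the eigenvalue: a path with the degrees on its diagonal. -/
theorem rho_K6_le {a b c d : ℕ} {t q₀ q₁ q₂ q₃ : ℝ} (ht : 0 < t)
    (h₀ : 0 < q₀) (h₁ : 0 < q₁) (h₂ : 0 < q₂) (h₃ : 0 < q₃)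
    (h0 : (a + 1) * q₀ + q₁ ≤ t ^ 2 * q₀) (h1 : q₀ + (b + 2) * q₁ + q₂ ≤ t ^ 2 * q₁)
    (h2 : q₁ + (c + 2) * q₂ + q₃ ≤ t ^ 2 * q₂) (h3 : q₂ + (d + 1) * q₃ ≤ t ^ 2 * q₃) :
    rho (K6 a b c d) ≤ t := by
  classical
  have : Nonempty (Fin 7 ⊕ ((i : Fin 4) × Fin (![a, b, c, d] i))) := ⟨.inl 0⟩
  refine rho_le_of_supersolution _
    (Sum.elim ![t * q₀, t * q₁, t * q₂, t * q₃, q₀ + q₁, q₁ + q₂, q₂ + q₃]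
      fun p => ![q₀, q₁, q₂, q₃] p.1) t ?_ ?_
  · rintro (i | ⟨i, j⟩)
    · fin_cases i <;> simp <;> positivity
    · simp only [Sum.elim_inr]
      fin_cases i <;> simpa
  · rintro (i | ⟨i, j⟩)
    · rw [Fintype.sum_sum_type, Fintype.sum_sigma]
      fin_cases i <;> simp [K6, attachLeaves, Fin.sum_univ_succ] <;> nlinarith
    · rw [Fintype.sum_sum_type, Fintype.sum_sigma]
      revert j
      fin_cases i <;> intro j <;> simp [K6, attachLeaves]

theorem exists_family_four_rho_sq_lt {n : ℕ} (hn : 11 ≤ n) :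
    ∃ H ∈ family n 4, 4 * rho H ^ 2 < n + 6 := by
  suffices h : ∃ a b c d : ℕ, 1 ≤ a ∧ a + b + c + d + 7 = n ∧
      ∃ s q₀ q₁ q₂ q₃ : ℝ, 0 < s ∧ 4 * s < n + 6 ∧ 0 < q₀ ∧ 0 < q₁ ∧ 0 < q₂ ∧ 0 < q₃ ∧
        (a + 1) * q₀ + q₁ ≤ s * q₀ ∧ q₀ + (b + 2) * q₁ + q₂ ≤ s * q₁ ∧
        q₁ + (c + 2) * q₂ + q₃ ≤ s * q₂ ∧ q₂ + (d + 1) * q₃ ≤ s * q₃ by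
    obtain ⟨a, b, c, d, ha, hsum, s, q₀, q₁, q₂, q₃, hs, hsn, p₀, p₁, p₂, p₃, h0, h1, h2, h3⟩ := h
    have hcard : Fintype.card (Fin n) =
        Fintype.card (Fin 7 ⊕ ((i : Fin 4) × Fin (![a, b, c, d] i))) := by
      simp [Fin.sum_univ_succ]
      omega
    let e := Fintype.equivOfCardEq hcard
    let φ : (K6 a b c d).comap e ≃g K6 a b c d := Iso.comap e _
    refine ⟨(K6 a b c d).comap e, ⟨φ.connected_iff.2 (connected_K6 a b c d),
      matchingNumber_comap_K6 ha e⟩, ?_⟩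
    have hsq : √s ^ 2 = s := Real.sq_sqrt hs.le
    have hle : rho (K6 a b c d) ≤ √s :=
      rho_K6_le (Real.sqrt_pos.2 hs) p₀ p₁ p₂ p₃ (by rwa [hsq]) (by rwa [hsq]) (by rwa [hsq])
        (by rwa [hsq])
    have : Nonempty (Fin n) := ⟨⟨0, by omega⟩⟩
    have hpow := pow_le_pow_left₀ (rho_nonneg _) ((rho_iso φ).trans_le hle) 2
    rw [hsq] at hpow
    linarith
  -- The degrees `a + 1, b + 2, c + 2, d + 1` sum to `n - 1 = 4 * (k + 2) + r`. They are taken equal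
  -- to `k + 2`, with `r` of them raised by one. Since `4 * s < n + 6`, the excess of `s` over `k +
  -- 2` must stay below `(7 + r) / 4`; the values `5/3, 19/10, 2, 12/5` do, and the `qᵢ` are
  -- approximate Perron vectors.
  obtain ⟨k, r, hr, hk⟩ : ∃ k r : ℕ, r < 4 ∧ n = 4 * (k + 2) + r + 1 :=
    ⟨(n - 1) / 4 - 2, (n - 1) % 4, Nat.mod_lt _ (by norm_num), by omega⟩
  subst hk
  interval_cases r
  · obtain ⟨k, rfl⟩ : ∃ j, k = j + 1 := ⟨k - 1, by omega⟩
    refine ⟨k + 2, k + 1, k + 1, k + 2, by omega, by omega, k + 3 + 5 / 3, 2, 3, 3, 2, ?_⟩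
    push_cast
    refine ⟨by positivity, ?_, ?_, ?_, ?_, ?_, ?_, ?_, ?_, ?_⟩ <;> linarith
  · refine ⟨k + 2, k, k, k + 1, by omega, by omega, k + 2 + 19 / 10, 1, 9 / 10, 71 / 100, 4 / 10, ?_⟩
    push_cast
    refine ⟨by positivity, ?_, ?_, ?_, ?_, ?_, ?_, ?_, ?_, ?_⟩ <;> linarith
  · refine ⟨k + 2, k, k, k + 2, by omega, by omega, k + 2 + 2, 1, 1, 1, 1, ?_⟩
    push_cast
    refine ⟨by positivity, ?_, ?_, ?_, ?_, ?_, ?_, ?_, ?_, ?_⟩ <;> linarith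
  · refine ⟨k + 2, k + 1, k, k + 2, by omega, by omega, k + 2 + 12 / 5, 1, 7 / 5, 24 / 25, 4 / 5, ?_⟩
    push_cast
    refine ⟨by positivity, ?_, ?_, ?_, ?_, ?_, ?_, ?_, ?_, ?_⟩ <;> linarith

end Reference

/-! ### Local structure of a minimizer around a cover of four vertices -/

section Minimizer

variable {n : ℕ} {T : SimpleGraph (Fin n)}

open Classical in
theorem IsMinimizer.not_bad (hn : 11 ≤ n) (hT : IsMinimizer n 4 T) {C : Finset (Fin n)}
    (hC : Covers T C) (hcard : C.card = 4) :
    ¬ ((∃ a ∈ C, ∃ b ∈ C, T.Adj a b) ∨ ∃ u ∉ C, 3 ≤ (C.filter (T.Adj u)).card) := by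
  intro hbad
  have h1 := le_four_mul_rho_sq hT.isTree hC hcard (by simpa using hn) hbad
  rw [Fintype.card_fin] at h1
  obtain ⟨H, hH, hlt⟩ := exists_family_four_rho_sq_lt hn
  have : Nonempty (Fin n) := ⟨⟨0, by omega⟩⟩
  have h2 := pow_le_pow_left₀ (rho_nonneg T) (hT.2 H hH) 2
  linarith

theorem IsMinimizer.not_adj (hn : 11 ≤ n) (hT : IsMinimizer n 4 T) {C : Finset (Fin n)}
    (hC : Covers T C) (hcard : C.card = 4) {a b : Fin n} (ha : a ∈ C) (hb : b ∈ C) :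
    ¬ T.Adj a b :=
  fun h => hT.not_bad hn hC hcard (Or.inl ⟨a, ha, b, hb, h⟩)

open Classical in
theorem IsMinimizer.card_filter_le (hn : 11 ≤ n) (hT : IsMinimizer n 4 T) {C : Finset (Fin n)}
    (hC : Covers T C) (hcard : C.card = 4) {u : Fin n} (hu : u ∉ C) :
    (C.filter (T.Adj u)).card ≤ 2 := by
  by_contra h
  exact hT.not_bad hn hC hcard (Or.inr ⟨u, hu, by omega⟩)

/-- The attachment vertices cover the skeleton by `hcov` and every pendant edge by construction, so
an isomorphism would carry them to a forbidden cover of `T`. -/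
theorem IsMinimizer.isEmpty_iso_attachLeaves (hn : 11 ≤ n) (hT : IsMinimizer n 4 T) {W : Type*}
    {S : SimpleGraph W} {h : Fin 4 → W} (hinj : h.Injective)
    (hcov : ∀ u v, S.Adj u v → (∃ i, h i = u) ∨ ∃ i, h i = v)
    (hbad : (∃ i j, S.Adj (h i) (h j)) ∨ ∃ u, (∀ i, h i ≠ u) ∧ ∃ i j k, i ≠ j ∧ i ≠ k ∧ j ≠ k ∧
      S.Adj u (h i) ∧ S.Adj u (h j) ∧ S.Adj u (h k)) (c : Fin 4 → ℕ) :
    IsEmpty (T ≃g attachLeaves S h c) := by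
  classical
  refine ⟨fun φ => ?_⟩
  let f : Fin 4 → Fin n := fun i => φ.symm (.inl (h i))
  have hf : f.Injective := fun i j hij => hinj (Sum.inl_injective (φ.symm.injective hij))
  have hadj : ∀ x y, T.Adj (φ.symm x) (φ.symm y) ↔ (attachLeaves S h c).Adj x y :=
    fun x y => φ.symm.map_adj_iff
  have hC : Covers T (Finset.univ.image f) := by
    intro u v huv
    obtain ⟨x, rfl⟩ := φ.symm.surjective u
    obtain ⟨y, rfl⟩ := φ.symm.surjective v
    rw [hadj] at huv
    have hmem : ∀ i, φ.symm (.inl (h i)) ∈ Finset.univ.image f := fun i =>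
      Finset.mem_image_of_mem f (Finset.mem_univ i)
    rcases x with x | p <;> rcases y with y | q
    · rcases hcov x y huv with ⟨i, rfl⟩ | ⟨i, rfl⟩
      · exact Or.inl (hmem i)
      · exact Or.inr (hmem i)
    · have huv : x = h q.1 := huv
      exact Or.inl (huv ▸ hmem q.1)
    · have huv : y = h p.1 := huv
      exact Or.inr (huv ▸ hmem p.1)
    · exact huv.elim
  have hcard : (Finset.univ.image f).card = 4 := by
    rw [Finset.card_image_of_injective _ hf]
    simp
  refine hT.not_bad hn hC hcard ?_
  rcases hbad with ⟨i, j, hij⟩ | ⟨u, hu, i, j, k, hij, hik, hjk, hi, hj, hk⟩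
  · exact Or.inl ⟨f i, by simp, f j, by simp, (hadj _ _).2 hij⟩
  · refine Or.inr ⟨φ.symm (.inl u), ?_, ?_⟩
    · simp only [Finset.mem_image, not_exists, f]
      intro l hl
      exact hu l (Sum.inl_injective (φ.symm.injective hl.2))
    · rw [← Finset.card_eq_three.2 ⟨f i, f j, f k, hf.ne hij, hf.ne hik, hf.ne hjk, rfl⟩]
      apply Finset.card_le_card
      intro x hx
      simp only [Finset.mem_insert, Finset.mem_singleton] at hx
      rw [Finset.mem_filter]
      rcases hx with rfl | rfl | rfl
      · exact ⟨by simp, (hadj _ _).2 hi⟩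
      · exact ⟨by simp, (hadj _ _).2 hj⟩
      · exact ⟨by simp, (hadj _ _).2 hk⟩

/-- A walk from `s` to `t` must leave the set formed by `S` and its neighbours outside `C`; as `C`
is an independent cover, it can only leave from such a neighbour into `C`. -/
theorem exists_common_neighbor {V : Type*} {G : SimpleGraph V} (hG : G.Connected) {C S : Finset V}
    (hC : Covers G C) (hind : ∀ a ∈ C, ∀ b ∈ C, ¬ G.Adj a b) (hSC : S ⊆ C) {s t : V} (hs : s ∈ S)
    (ht : t ∈ C) (htS : t ∉ S) :
    ∃ a ∈ S, ∃ b ∈ C, b ∉ S ∧ ∃ u ∉ C, G.Adj u a ∧ G.Adj u b := by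
  obtain ⟨p⟩ := hG.preconnected s t
  obtain ⟨d, -, hd1, hd2⟩ := p.exists_boundary_dart
    {w | w ∈ S ∨ (w ∉ C ∧ ∃ a ∈ S, G.Adj w a)} (Or.inl hs) (by
      rintro (h | h)
      · exact htS h
      · exact h.1 ht)
  rcases hd1 with h | ⟨h, a, ha, hda⟩
  · have hsnd : d.snd ∉ C := fun hc => hind _ (hSC h) _ hc d.adj
    exact (hd2 (Or.inr ⟨hsnd, d.fst, h, d.adj.symm⟩)).elim
  · have hsnd : d.snd ∈ C := (hC d.adj).resolve_left h
    exact ⟨a, ha, d.snd, hsnd, fun hc => hd2 (Or.inl hc), d.fst, h, hda, d.adj⟩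

/-- In a minimizer, a vertex of the cover is not a leaf whose only neighbour is shared with another
vertex of the cover. -/
theorem IsMinimizer.exists_ne_adj (hn : 11 ≤ n) (hT : IsMinimizer n 4 T) {C : Finset (Fin n)}
    (hC : Covers T C) (hcard : C.card = 4) {u v v' : Fin n} (hu : u ∉ C) (hv : v ∈ C) (hv' : v' ∈ C)
    (hne : v' ≠ v) (huv' : T.Adj u v') : ∃ w, w ≠ u ∧ T.Adj v w := by
  by_contra hcon
  push Not at hcon
  -- If `u` is the only possible neighbour of `v`, exchanging `v` for `u` keeps a cover of size
  -- four, but this one contains the edge `u v'`.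
  have hC' : Covers T (insert u (C.erase v)) := by
    intro x y hxy
    simp only [Finset.mem_insert, Finset.mem_erase]
    by_cases hx : x = v
    · subst hx
      by_contra h
      exact hcon y (by tauto) hxy
    by_cases hy : y = v
    · subst hy
      by_contra h
      exact hcon x (by tauto) hxy.symm
    have := hC hxy
    tauto
  refine hT.not_adj hn hC' ?_ (Finset.mem_insert_self _ _)
    (Finset.mem_insert_of_mem (Finset.mem_erase.2 ⟨hne, hv'⟩)) huv'
  rw [Finset.card_insert_of_notMem (fun h => hu (Finset.mem_of_mem_erase h)),
    Finset.card_erase_of_mem hv, hcard]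

-- The `n - 4` outside vertices have one or two neighbours in `C` and account for all `n - 1` edges,
-- so the surplus is three.
open Classical in
theorem IsMinimizer.card_filter_two (hn : 11 ≤ n) (hT : IsMinimizer n 4 T) {C : Finset (Fin n)}
    (hC : Covers T C) (hcard : C.card = 4) :
    (Cᶜ.filter fun u => (C.filter (T.Adj u)).card = 2).card = 3 := by
  have hsum : innerSum T C + 2 * ∑ u ∈ Cᶜ, degIn T C u = 2 * ((Fintype.card (Fin n) : ℝ) - 1) := by
    convert sum_degIn_of_isTree hT.isTree hC
  have hE : innerSum T C = 0 := Finset.sum_eq_zero fun v hv => Finset.sum_eq_zero fun w hw =>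
    if_neg (hT.not_adj hn hC hcard hv hw)
  have hterm : ∀ u ∈ Cᶜ, degIn T C u = 1 + if (C.filter (T.Adj u)).card = 2 then 1 else 0 := by
    intro u hu
    have h1 := degIn_pos hT.isTree.connected hC (Finset.card_pos.1 (by omega))
      (Finset.mem_compl.1 hu)
    have h2 := hT.card_filter_le hn hC hcard (Finset.mem_compl.1 hu)
    rw [degIn_eq_card] at h1 ⊢
    rw [Nat.one_le_cast] at h1
    interval_cases (C.filter (T.Adj u)).card <;> norm_num
  rw [hE, Finset.sum_congr rfl hterm, Finset.sum_add_distrib, Finset.sum_boole, Finset.sum_const,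
    Finset.card_compl, hcard, Fintype.card_fin, nsmul_one, Nat.cast_sub (by omega)] at hsum
  have : ((Cᶜ.filter fun u => (C.filter (T.Adj u)).card = 2).card : ℝ) = 3 := by
    push_cast at hsum
    linarith
  exact_mod_cast this

end Minimizer

/-! ### Reconstructing the tree from its skeleton and pendant vertices -/

section Skeleton

theorem nonempty_iso_attachLeaves {V W : Type*} {T : SimpleGraph V} {S : SimpleGraph W}
    {h : Fin 4 → W} {φ : W → V} (hh : h.Injective) (hφ : φ.Injective)
    (hadj : ∀ a b, T.Adj (φ a) (φ b) ↔ S.Adj a b)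
    (hout : ∀ p ∉ Set.range φ, ∃ i, ∀ w, T.Adj p w ↔ w = φ (h i)) {c : Fin 4 → ℕ}
    (e : ∀ i, Fin (c i) ≃ {p // p ∉ Set.range φ ∧ T.Adj p (φ (h i))}) :
    Nonempty (T ≃g attachLeaves S h c) := by
  let F : W ⊕ ((i : Fin 4) × Fin (c i)) → V := Sum.elim φ fun p => (e p.1 p.2).1
  have hleaf : ∀ (p : (i : Fin 4) × Fin (c i)) (w : V), T.Adj (F (.inr p)) w ↔ w = φ (h p.1) := by
    rintro ⟨i, j⟩ w
    obtain ⟨k, hk⟩ := hout _ (e i j).2.1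
    have h1 := (hk _).1 (e i j).2.2
    rw [h1]
    exact hk w
  have hinj : F.Injective := by
    rintro (a | p) (b | q) hab
    · exact congrArg _ (hφ hab)
    · exact ((e q.1 q.2).2.1 ⟨a, hab⟩).elim
    · exact ((e p.1 p.2).2.1 ⟨b, hab.symm⟩).elim
    · have h1 := (hleaf p _).2 rfl
      rw [hab, hleaf q] at h1
      obtain ⟨i, j⟩ := p
      obtain ⟨i', j'⟩ := q
      obtain rfl : i = i' := hh (hφ h1)
      have : j = j' := (e i).injective (Subtype.ext hab)
      rw [this]
  have hsurj : F.Surjective := by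
    intro p
    by_cases hp : p ∈ Set.range φ
    · obtain ⟨a, rfl⟩ := hp
      exact ⟨.inl a, rfl⟩
    · obtain ⟨i, hi⟩ := hout p hp
      exact ⟨.inr ⟨i, (e i).symm ⟨p, hp, (hi _).2 rfl⟩⟩, by simp [F]⟩
  refine ⟨Iso.symm ⟨Equiv.ofBijective F ⟨hinj, hsurj⟩, ?_⟩⟩
  rintro (a | p) (b | q)
  · exact hadj a b
  · change T.Adj (φ a) (F (.inr q)) ↔ a = h q.1
    rw [T.adj_comm, hleaf, hφ.eq_iff]
  · change T.Adj (F (.inr p)) (φ b) ↔ b = h p.1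
    rw [hleaf, hφ.eq_iff]
  · change T.Adj (F (.inr p)) (F (.inr q)) ↔ False
    rw [hleaf, iff_false]
    intro hq
    exact (e q.1 q.2).2.1 ⟨_, hq.symm⟩

/-- The pairs `ε₁ k, ε₂ k` are the edges of a graph on four vertices and `S` is its subdivision, so
path and star are treated at once. The last clause concerns an end lying on no other edge. -/
theorem IsMinimizer.exists_iso_attachLeaves {n : ℕ} {T : SimpleGraph (Fin n)} (hn : 11 ≤ n)
    (hT : IsMinimizer n 4 T) {C : Finset (Fin n)} (hC : Covers T C) (hcard : C.card = 4)
    {S : SimpleGraph (Fin (4 + 3))} {ε₁ ε₂ : Fin 3 → Fin 4} (hε : ∀ k, ε₁ k ≠ ε₂ k)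
    (hεinj : ∀ k l, s(ε₁ k, ε₂ k) = s(ε₁ l, ε₂ l) → k = l)
    (hSl : ∀ i j, ¬ S.Adj (Fin.castAdd 3 i) (Fin.castAdd 3 j))
    (hSr : ∀ i j, ¬ S.Adj (Fin.natAdd 4 i) (Fin.natAdd 4 j))
    (hS : ∀ k i, S.Adj (Fin.natAdd 4 k) (Fin.castAdd 3 i) ↔ i = ε₁ k ∨ i = ε₂ k)
    {v : Fin 4 → Fin n} (hv : v.Injective) (hvC : ∀ i, v i ∈ C) {u : Fin 3 → Fin n}
    (huC : ∀ k, u k ∉ C) (hu₁ : ∀ k, T.Adj (u k) (v (ε₁ k))) (hu₂ : ∀ k, T.Adj (u k) (v (ε₂ k))) :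
    ∃ c : Fin 4 → ℕ, Nonempty (T ≃g attachLeaves S (Fin.castAdd 3) c) ∧ 7 + ∑ i, c i = n ∧
      ∀ k, ((∀ l, l ≠ k → ε₁ l ≠ ε₁ k ∧ ε₂ l ≠ ε₁ k) → 1 ≤ c (ε₁ k)) ∧
        ((∀ l, l ≠ k → ε₁ l ≠ ε₂ k ∧ ε₂ l ≠ ε₂ k) → 1 ≤ c (ε₂ k)) := by
  classical
  have hvsurj : ∀ w ∈ C, ∃ i, w = v i := by
    have : Finset.univ.image v = C := Finset.eq_of_subset_of_card_le
      (by intro x hx; obtain ⟨i, -, rfl⟩ := Finset.mem_image.1 hx; exact hvC i)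
      (by rw [Finset.card_image_of_injective _ hv, hcard]; simp)
    intro w hw
    rw [← this] at hw
    obtain ⟨i, -, rfl⟩ := Finset.mem_image.1 hw
    exact ⟨i, rfl⟩
  have hfilter : ∀ k, C.filter (T.Adj (u k)) = {v (ε₁ k), v (ε₂ k)} := by
    intro k
    symm
    apply Finset.eq_of_subset_of_card_le
    · intro x hx
      simp only [Finset.mem_insert, Finset.mem_singleton] at hx
      rcases hx with rfl | rfl
      · exact Finset.mem_filter.2 ⟨hvC _, hu₁ k⟩
      · exact Finset.mem_filter.2 ⟨hvC _, hu₂ k⟩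
    · rw [Finset.card_pair (hv.ne (hε k))]
      exact hT.card_filter_le hn hC hcard (huC k)
  have huadj : ∀ k w, T.Adj (u k) w ↔ w = v (ε₁ k) ∨ w = v (ε₂ k) := by
    intro k w
    constructor
    · intro h
      have : w ∈ C.filter (T.Adj (u k)) := Finset.mem_filter.2 ⟨(hC h).resolve_left (huC k), h⟩
      simpa [hfilter k] using this
    · rintro (rfl | rfl)
      exacts [hu₁ k, hu₂ k]
  have huinj : u.Injective := by
    intro k l hkl
    apply hεinj
    have h1 := hu₁ k
    have h2 := hu₂ k
    rw [hkl, huadj, hv.eq_iff, hv.eq_iff] at h1 h2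
    have := hε k
    rw [Sym2.eq_iff]
    rcases h1 with h1 | h1 <;> rcases h2 with h2 | h2 <;> grind
  -- By `IsMinimizer.card_filter_two` the three given vertices exhaust those with two neighbours in
  -- `C`; everything else outside `C` is therefore pendant.
  have hdeg2 : Finset.univ.image u = Cᶜ.filter fun u => (C.filter (T.Adj u)).card = 2 := by
    apply Finset.eq_of_subset_of_card_le
    · intro x hx
      obtain ⟨k, -, rfl⟩ := Finset.mem_image.1 hx
      rw [Finset.mem_filter, Finset.mem_compl, hfilter k, Finset.card_pair (hv.ne (hε k))]
      exact ⟨huC k, rfl⟩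
    · rw [Finset.card_image_of_injective _ huinj, hT.card_filter_two hn hC hcard]
      simp
  let φ : Fin (4 + 3) → Fin n := Fin.append v u
  have hφl : ∀ i, φ (Fin.castAdd 3 i) = v i := Fin.append_left v u
  have hφr : ∀ k, φ (Fin.natAdd 4 k) = u k := Fin.append_right v u
  have hφ : φ.Injective := by
    intro a b
    refine Fin.addCases (fun i => ?_) (fun k => ?_) a <;>
      refine Fin.addCases (fun j => ?_) (fun l => ?_) b <;> simp only [hφl, hφr]
    · exact fun h => congrArg _ (hv h)
    · exact fun h => (huC l (h ▸ hvC i)).elim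
    · exact fun h => (huC k (h ▸ hvC j)).elim
    · exact fun h => congrArg _ (huinj h)
  have hadj : ∀ a b, T.Adj (φ a) (φ b) ↔ S.Adj a b := by
    intro a b
    refine Fin.addCases (fun i => ?_) (fun k => ?_) a <;>
      refine Fin.addCases (fun j => ?_) (fun l => ?_) b <;> simp only [hφl, hφr]
    · exact iff_of_false (hT.not_adj hn hC hcard (hvC i) (hvC j)) (hSl i j)
    · rw [T.adj_comm, S.adj_comm, huadj, hS, hv.eq_iff, hv.eq_iff]
    · rw [huadj, hS, hv.eq_iff, hv.eq_iff]
    · exact iff_of_false (fun h => (hC h).elim (huC k) (huC l)) (hSr k l)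
  have hrange : ∀ p, p ∉ Set.range φ ↔ p ∉ C ∧ ∀ k, p ≠ u k := by
    intro p
    constructor
    · intro h
      refine ⟨fun hp => ?_, fun k hk => h ⟨_, (hφr k).trans hk.symm⟩⟩
      obtain ⟨i, rfl⟩ := hvsurj p hp
      exact h ⟨_, hφl i⟩
    · rintro ⟨h1, h2⟩ ⟨a, rfl⟩
      revert h1 h2
      refine Fin.addCases (fun i => ?_) (fun k => ?_) a <;> simp only [hφl, hφr]
      · exact fun h _ => h (hvC i)
      · exact fun _ h => h k rfl
  have hout : ∀ p ∉ Set.range φ, ∃ i, ∀ w, T.Adj p w ↔ w = φ (Fin.castAdd 3 i) := by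
    intro p hp
    obtain ⟨hpC, hpu⟩ := (hrange p).1 hp
    have h1 := degIn_pos hT.isTree.connected hC (Finset.card_pos.1 (by omega)) hpC
    have h2 := hT.card_filter_le hn hC hcard hpC
    have h3 : (C.filter (T.Adj p)).card ≠ 2 := by
      intro h
      have : p ∈ Finset.univ.image u := by
        rw [hdeg2]
        exact Finset.mem_filter.2 ⟨Finset.mem_compl.2 hpC, h⟩
      obtain ⟨k, -, rfl⟩ := Finset.mem_image.1 this
      exact hpu k rfl
    rw [degIn_eq_card, Nat.one_le_cast] at h1
    obtain ⟨x, hx⟩ := Finset.card_eq_one.1 (show (C.filter (T.Adj p)).card = 1 by omega)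
    have hx' : x ∈ C.filter (T.Adj p) := by simp [hx]
    rw [Finset.mem_filter] at hx'
    obtain ⟨i, rfl⟩ := hvsurj x hx'.1
    refine ⟨i, fun w => ?_⟩
    rw [hφl]
    constructor
    · intro hw
      have : w ∈ C.filter (T.Adj p) := Finset.mem_filter.2 ⟨(hC hw).resolve_left hpC, hw⟩
      simpa [hx] using this
    · rintro rfl
      exact hx'.2
  let c : Fin 4 → ℕ := fun i =>
    Fintype.card {p // p ∉ Set.range φ ∧ T.Adj p (φ (Fin.castAdd 3 i))}
  have hiso : Nonempty (T ≃g attachLeaves S (Fin.castAdd 3) c) :=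
    nonempty_iso_attachLeaves (Fin.castAdd_injective 4 3) hφ hadj hout
      fun i => (Fintype.equivFin _).symm
  have hpos : ∀ k i j, T.Adj (u k) (v i) → T.Adj (u k) (v j) → i ≠ j →
      (∀ l, l ≠ k → ε₁ l ≠ i ∧ ε₂ l ≠ i) → 1 ≤ c i := by
    intro k i j hi hj hij hl
    obtain ⟨w, hwu, hw⟩ := hT.exists_ne_adj hn hC hcard (huC k) (hvC i) (hvC j) (hv.ne hij.symm) hj
    have hwC : w ∉ C := fun h => hT.not_adj hn hC hcard (hvC i) h hw
    refine Fintype.card_pos_iff.2 ⟨⟨w, (hrange w).2 ⟨hwC, ?_⟩, by rw [hφl]; exact hw.symm⟩⟩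
    rintro l rfl
    have hlk : l ≠ k := fun h => hwu (h ▸ rfl)
    have := (huadj l _).1 hw.symm
    rw [hv.eq_iff, hv.eq_iff] at this
    have := hl l hlk
    tauto
  refine ⟨c, hiso, ?_, fun k => ⟨fun hl => ?_, fun hl => ?_⟩⟩
  · obtain ⟨f⟩ := hiso
    have := Fintype.card_congr f.toEquiv
    simpa using this.symm
  · exact hpos k _ _ (hu₁ k) (hu₂ k) (hε k) hl
  · exact hpos k _ _ (hu₂ k) (hu₁ k) (hε k).symm hl

end Skeleton

/-! ### Path or star, and exclusion of the remaining families -/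

section Classification

theorem exists_eq_vec (c : Fin 4 → ℕ) : ∃ a b d e : ℕ, c = ![a, b, d, e] :=
  ⟨c 0, c 1, c 2, c 3, by ext i; fin_cases i <;> rfl⟩

theorem castAdd_eq_vec : Fin.castAdd 3 = (![0, 1, 2, 3] : Fin 4 → Fin (4 + 3)) := by
  ext i
  fin_cases i <;> rfl

variable {n : ℕ} {T : SimpleGraph (Fin n)}

theorem IsMinimizer.exists_iso_K6 (hn : 11 ≤ n) (hT : IsMinimizer n 4 T) {C : Finset (Fin n)}
    (hC : Covers T C) (hcard : C.card = 4) {v : Fin 4 → Fin n} (hv : v.Injective)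
    (hvC : ∀ i, v i ∈ C) {u : Fin 3 → Fin n} (huC : ∀ k, u k ∉ C)
    (hu₁ : ∀ k, T.Adj (u k) (v (![0, 1, 2] k))) (hu₂ : ∀ k, T.Adj (u k) (v (![1, 2, 3] k))) :
    ∃ a b c d : ℕ, a + b + c + d + 7 = n ∧ 1 ≤ a ∧ 1 ≤ d ∧ Nonempty (T ≃g K6 a b c d) := by
  obtain ⟨c, hiso, hsum, hpos⟩ := hT.exists_iso_attachLeaves hn hC hcard
    (S := fromEdgeSet {s(0, 4), s(4, 1), s(1, 5), s(5, 2), s(2, 6), s(6, 3)})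
    (ε₁ := ![0, 1, 2]) (ε₂ := ![1, 2, 3]) (by decide) (by decide)
    (by intro i j; fin_cases i <;> fin_cases j <;> simp [Fin.castAdd, Fin.castLE])
    (by intro i j; fin_cases i <;> fin_cases j <;> simp [Fin.natAdd])
    (by intro i j; fin_cases i <;> fin_cases j <;> simp [Fin.natAdd, Fin.castAdd, Fin.castLE])
    hv hvC huC hu₁ hu₂
  obtain ⟨a, b, c, d, rfl⟩ := exists_eq_vec c
  rw [castAdd_eq_vec] at hiso
  refine ⟨a, b, c, d, ?_, ?_, ?_, hiso⟩
  · simp [Fin.sum_univ_succ] at hsum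
    omega
  · exact (hpos 0).1 (by decide)
  · exact (hpos 2).2 (by decide)

theorem IsMinimizer.exists_iso_K10 (hn : 11 ≤ n) (hT : IsMinimizer n 4 T) {C : Finset (Fin n)}
    (hC : Covers T C) (hcard : C.card = 4) {v : Fin 4 → Fin n} (hv : v.Injective)
    (hvC : ∀ i, v i ∈ C) {u : Fin 3 → Fin n} (huC : ∀ k, u k ∉ C)
    (hu₁ : ∀ k, T.Adj (u k) (v (![1, 1, 1] k))) (hu₂ : ∀ k, T.Adj (u k) (v (![0, 2, 3] k))) :
    ∃ a b c d : ℕ, a + b + c + d + 7 = n ∧ 1 ≤ a ∧ 1 ≤ c ∧ 1 ≤ d ∧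
      Nonempty (T ≃g K10 a b c d) := by
  obtain ⟨c, hiso, hsum, hpos⟩ := hT.exists_iso_attachLeaves hn hC hcard
    (S := fromEdgeSet {s(0, 4), s(4, 1), s(1, 5), s(5, 2), s(1, 6), s(6, 3)})
    (ε₁ := ![1, 1, 1]) (ε₂ := ![0, 2, 3]) (by decide) (by decide)
    (by intro i j; fin_cases i <;> fin_cases j <;> simp [Fin.castAdd, Fin.castLE])
    (by intro i j; fin_cases i <;> fin_cases j <;> simp [Fin.natAdd])
    (by intro i j; fin_cases i <;> fin_cases j <;> simp [Fin.natAdd, Fin.castAdd, Fin.castLE])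
    hv hvC huC hu₁ hu₂
  obtain ⟨a, b, c, d, rfl⟩ := exists_eq_vec c
  rw [castAdd_eq_vec] at hiso
  refine ⟨a, b, c, d, ?_, ?_, ?_, ?_, hiso⟩
  · simp [Fin.sum_univ_succ] at hsum
    omega
  · exact (hpos 0).2 (by decide)
  · exact (hpos 1).2 (by decide)
  · exact (hpos 2).2 (by decide)

theorem injective_vec_four {V : Type*} {p q r s : V} (hpq : p ≠ q) (hpr : p ≠ r) (hps : p ≠ s)
    (hqr : q ≠ r) (hqs : q ≠ s) (hrs : r ≠ s) : Function.Injective ![p, q, r, s] := by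
  intro i j h
  fin_cases i <;> fin_cases j <;> simp_all

theorem IsMinimizer.exists_iso (hn : 11 ≤ n) (hT : IsMinimizer n 4 T) :
    ∃ a b c d : ℕ, a + b + c + d + 7 = n ∧
      ((1 ≤ a ∧ 1 ≤ d ∧ Nonempty (T ≃g K6 a b c d)) ∨
        (1 ≤ a ∧ 1 ≤ c ∧ 1 ≤ d ∧ Nonempty (T ≃g K10 a b c d))) := by
  obtain ⟨C, hC, hcard⟩ := exists_covers_card_eq hT.isTree.isAcyclic hT.1.2.le
    (by rw [Fintype.card_fin]; omega)
  have hind : ∀ a ∈ C, ∀ b ∈ C, ¬ T.Adj a b := fun a ha b hb => hT.not_adj hn hC hcard ha hb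
  have path : ∀ p q r s : Fin n, p ≠ q → p ≠ r → p ≠ s → q ≠ r → q ≠ s → r ≠ s → p ∈ C → q ∈ C →
      r ∈ C → s ∈ C → ∀ u₁ ∉ C, ∀ u₂ ∉ C, ∀ u₃ ∉ C, T.Adj u₁ p → T.Adj u₁ q → T.Adj u₂ q →
      T.Adj u₂ r → T.Adj u₃ r → T.Adj u₃ s → ∃ a b c d : ℕ, a + b + c + d + 7 = n ∧
        1 ≤ a ∧ 1 ≤ d ∧ Nonempty (T ≃g K6 a b c d) := by
    intro p q r s hpq hpr hps hqr hqs hrs hp hq hr hs u₁ hu₁ u₂ hu₂ u₃ hu₃ h1 h2 h3 h4 h5 h6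
    refine hT.exists_iso_K6 hn hC hcard (v := ![p, q, r, s]) (u := ![u₁, u₂, u₃])
      (injective_vec_four hpq hpr hps hqr hqs hrs) ?_ ?_ ?_ ?_ <;>
    · intro i
      fin_cases i <;> assumption
  have star : ∀ p q r s : Fin n, p ≠ q → p ≠ r → p ≠ s → q ≠ r → q ≠ s → r ≠ s → p ∈ C → q ∈ C →
      r ∈ C → s ∈ C → ∀ u₁ ∉ C, ∀ u₂ ∉ C, ∀ u₃ ∉ C, T.Adj u₁ p → T.Adj u₁ q → T.Adj u₂ q →
      T.Adj u₂ r → T.Adj u₃ q → T.Adj u₃ s → ∃ a b c d : ℕ, a + b + c + d + 7 = n ∧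
        1 ≤ a ∧ 1 ≤ c ∧ 1 ≤ d ∧ Nonempty (T ≃g K10 a b c d) := by
    intro p q r s hpq hpr hps hqr hqs hrs hp hq hr hs u₁ hu₁ u₂ hu₂ u₃ hu₃ h1 h2 h3 h4 h5 h6
    refine hT.exists_iso_K10 hn hC hcard (v := ![p, q, r, s]) (u := ![u₁, u₂, u₃])
      (injective_vec_four hpq hpr hps hqr hqs hrs) ?_ ?_ ?_ ?_ <;>
    · intro i
      fin_cases i <;> assumption
  -- The tree on `C` is grown one vertex at a time. The second new vertex has two possible
  -- attachment points and the third has three; two of the six outcomes are stars and four are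
  -- paths.
  have step : ∀ S ⊆ C, S.Nonempty → S.card < 4 →
      ∃ a ∈ S, ∃ b ∈ C, b ∉ S ∧ ∃ u ∉ C, T.Adj u a ∧ T.Adj u b := by
    intro S hSC ⟨s, hs⟩ hlt
    obtain ⟨t, ht, htS⟩ := Finset.exists_mem_notMem_of_card_lt_card (hcard ▸ hlt)
    exact exists_common_neighbor hT.isTree.connected hC hind hSC hs ht htS
  obtain ⟨w, hw⟩ := Finset.card_pos.1 (show 0 < C.card by omega)
  obtain ⟨w', hw', x, hx, hxS, u₁, hu₁, h1, h1'⟩ := step {w} (by simpa using hw) (by simp) (by simp)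
  obtain rfl : w' = w := by simpa using hw'
  obtain ⟨a, ha, y, hy, hyS, u₂, hu₂, h2, h2'⟩ := step {w', x}
    (by simp [Finset.insert_subset_iff, hw, hx]) (by simp)
    (lt_of_le_of_lt (Finset.card_le_two) (by norm_num))
  obtain ⟨b, hb, z, hz, hzS, u₃, hu₃, h3, h3'⟩ := step {w', x, y}
    (by simp [Finset.insert_subset_iff, hw, hx, hy]) (by simp)
    (lt_of_le_of_lt (Finset.card_le_three) (by norm_num))
  simp only [Finset.mem_insert, Finset.mem_singleton, not_or] at hxS ha hyS hb hzS
  obtain ⟨hyw, hyx⟩ := hyS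
  obtain ⟨hzw, hzx, hzy⟩ := hzS
  rcases ha with rfl | rfl <;> rcases hb with rfl | rfl | rfl
  · obtain ⟨a, b, c, d, hs, h⟩ := star x _ y z hxS (Ne.symm hyx) (Ne.symm hzx) (Ne.symm hyw)
      (Ne.symm hzw) (Ne.symm hzy) hx hw hy hz u₁ hu₁ u₂ hu₂ u₃ hu₃ h1' h1 h2 h2' h3 h3'
    exact ⟨a, b, c, d, hs, Or.inr h⟩
  · obtain ⟨a, b, c, d, hs, h⟩ := path y _ _ z hyw hyx (Ne.symm hzy) (Ne.symm hxS) (Ne.symm hzw)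
      (Ne.symm hzx) hy hw hx hz u₂ hu₂ u₁ hu₁ u₃ hu₃ h2' h2 h1 h1' h3 h3'
    exact ⟨a, b, c, d, hs, Or.inl h⟩
  · obtain ⟨a, b, c, d, hs, h⟩ := path x _ _ z hxS (Ne.symm hyx) (Ne.symm hzx) (Ne.symm hyw)
      (Ne.symm hzw) (Ne.symm hzy) hx hw hy hz u₁ hu₁ u₂ hu₂ u₃ hu₃ h1' h1 h2 h2' h3 h3'
    exact ⟨a, b, c, d, hs, Or.inl h⟩
  · obtain ⟨a, b, c, d, hs, h⟩ := path y _ _ z hyx hyw (Ne.symm hzy) hxS (Ne.symm hzx)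
      (Ne.symm hzw) hy hx hw hz u₂ hu₂ u₁ hu₁ u₃ hu₃ h2' h2 h1' h1 h3 h3'
    exact ⟨a, b, c, d, hs, Or.inl h⟩
  · obtain ⟨a, b, c, d, hs, h⟩ := star _ _ y z (Ne.symm hxS) (Ne.symm hyw) (Ne.symm hzw)
      (Ne.symm hyx) (Ne.symm hzx) (Ne.symm hzy) hw hx hy hz u₁ hu₁ u₂ hu₂ u₃ hu₃ h1 h1' h2 h2' h3 h3'
    exact ⟨a, b, c, d, hs, Or.inr h⟩
  · obtain ⟨a, b, c, d, hs, h⟩ := path _ _ _ z (Ne.symm hxS) (Ne.symm hyw) (Ne.symm hzw)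
      (Ne.symm hyx) (Ne.symm hzx) (Ne.symm hzy) hw hx hy hz u₁ hu₁ u₂ hu₂ u₃ hu₃ h1 h1' h2 h2' h3 h3'
    exact ⟨a, b, c, d, hs, Or.inl h⟩

theorem fromEdgeSet_covered {m : ℕ} {s : Set (Sym2 (Fin m))} {h : Fin 4 → Fin m}
    (H : ∀ e ∈ s, ∃ i, h i ∈ e) (u v : Fin m) (huv : (fromEdgeSet s).Adj u v) :
    (∃ i, h i = u) ∨ ∃ i, h i = v := by
  obtain ⟨i, hi⟩ := H _ ((fromEdgeSet_adj _).1 huv).1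
  exact (Sym2.mem_iff.1 hi).imp (fun h => ⟨i, h⟩) (fun h => ⟨i, h⟩)

end Classification

end MinSpectral

theorem proposition4p11 (n : ℕ) (hn : 11 ≤ n) (T : SimpleGraph (Fin n))
    (hT : MinSpectral.IsMinimizer n 4 T) :
    (∃ a b c d : ℕ, a + b + c + d + 7 = n ∧
        ((1 ≤ a ∧ 1 ≤ d ∧ Nonempty (T ≃g MinSpectral.K6 a b c d)) ∨
          (1 ≤ a ∧ 1 ≤ c ∧ 1 ≤ d ∧ Nonempty (T ≃g MinSpectral.K10 a b c d)))) ∧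
      (∀ a b c d : ℕ,
        IsEmpty (T ≃g MinSpectral.K1 a b c d) ∧
        IsEmpty (T ≃g MinSpectral.K2 a b c d) ∧
        IsEmpty (T ≃g MinSpectral.K3 a b c d) ∧
        IsEmpty (T ≃g MinSpectral.K4 a b c d) ∧
        IsEmpty (T ≃g MinSpectral.K5 a b c d) ∧
        IsEmpty (T ≃g MinSpectral.K7 a b c d) ∧
        IsEmpty (T ≃g MinSpectral.K8 a b c d) ∧
        IsEmpty (T ≃g MinSpectral.K9 a b c d) ∧
        IsEmpty (T ≃g MinSpectral.K11 a b c d) ∧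
        IsEmpty (T ≃g MinSpectral.K12 a b c d) ∧
        IsEmpty (T ≃g MinSpectral.K13 a b c d)) := by
  refine ⟨hT.exists_iso hn, fun a b c d => ?_⟩
  -- Each witness is an edge between two attachment vertices, except for `K12` and `K13`, where `u₁`
  -- (vertex `4`) has three neighbours among them. The indices are positions in the attachment
  -- vector, which for `K11` and `K12` is `![0, 2, 3, 1]`.
  refine ⟨?_, ?_, ?_, ?_, ?_, ?_, ?_, ?_, ?_, ?_, ?_⟩
  · exact hT.isEmpty_iso_attachLeaves hn (by decide)
      (MinSpectral.fromEdgeSet_covered (by simp [Fin.exists_fin_succ])) (Or.inl ⟨0, 1, by simp⟩) _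
  · exact hT.isEmpty_iso_attachLeaves hn (by decide)
      (MinSpectral.fromEdgeSet_covered (by simp [Fin.exists_fin_succ])) (Or.inl ⟨1, 2, by simp⟩) _
  · exact hT.isEmpty_iso_attachLeaves hn (by decide)
      (MinSpectral.fromEdgeSet_covered (by simp [Fin.exists_fin_succ])) (Or.inl ⟨0, 1, by simp⟩) _
  · exact hT.isEmpty_iso_attachLeaves hn (by decide)
      (MinSpectral.fromEdgeSet_covered (by simp [Fin.exists_fin_succ])) (Or.inl ⟨2, 3, by simp⟩) _
  · exact hT.isEmpty_iso_attachLeaves hn (by decide)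
      (MinSpectral.fromEdgeSet_covered (by simp [Fin.exists_fin_succ])) (Or.inl ⟨1, 2, by simp⟩) _
  · exact hT.isEmpty_iso_attachLeaves hn (by decide)
      (MinSpectral.fromEdgeSet_covered (by simp [Fin.exists_fin_succ])) (Or.inl ⟨0, 1, by simp⟩) _
  · exact hT.isEmpty_iso_attachLeaves hn (by decide)
      (MinSpectral.fromEdgeSet_covered (by simp [Fin.exists_fin_succ])) (Or.inl ⟨1, 2, by simp⟩) _
  · exact hT.isEmpty_iso_attachLeaves hn (by decide)
      (MinSpectral.fromEdgeSet_covered (by simp [Fin.exists_fin_succ])) (Or.inl ⟨1, 3, by simp⟩) _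
  · exact hT.isEmpty_iso_attachLeaves hn (by decide)
      (MinSpectral.fromEdgeSet_covered (by simp [Fin.exists_fin_succ]))
      (Or.inl ⟨1, 2, by simp⟩) _
  · exact hT.isEmpty_iso_attachLeaves hn (by decide)
      (MinSpectral.fromEdgeSet_covered (by simp [Fin.exists_fin_succ]))
      (Or.inr ⟨4, by decide, 0, 1, 3, by decide, by decide, by decide, by simp⟩) _
  · exact hT.isEmpty_iso_attachLeaves hn (by decide)
      (MinSpectral.fromEdgeSet_covered (by simp [Fin.exists_fin_succ]))
      (Or.inr ⟨4, by decide, 0, 1, 2, by decide, by decide, by decide, by simp⟩) _
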